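/- **Setting.** Let $C\subset\mathbb R^n$ be nonempty, open and convex. For $F:\mathbb R^n\to(-\infty,+\infty]$ let $\operatorname{dom}F=\{F<+\infty\}$; $\hat\partial F(x)=\{\xi:\liminf_{y\to x,\,y\ne x}\frac{F(y)-F(x)-\langle\xi,y-x\rangle}{\|x-y\|}\ge 0\}$ for $x\in\operatorname{dom}F$ (and $\emptyset$ otherwise); for $x\in\operatorname{dom}F$ the limiting subdifferential $\partial F(x)$ is the set of limits of $\xi^k\in\hat\partial F(x^k)$ with $x^k\to x$, $F(x^k)\to F(x)$ (and $\partial F(x)=\emptyset$ otherwise); $\operatorname{dom}\partial F=\{x:\partial F(x)\neq\emptyset\}$. $\delta_S$ is the indicator function of $S$ ($0$ on $S$, $+\infty$ elsewhere). Assume: 1. $\phi:\mathbb R^n\to(-\infty,+\infty]$ is proper, lower semicontinuous and convex, $\operatorname{dom}\phi\subset\operatorname{cl}C=\operatorname{cl}\operatorname{dom}\phi$, $\operatorname{dom}\partial\phi=C=\operatorname{int}\operatorname{dom}\phi$, and $\phi$ is $\mathcal C^2$ and $\sigma$-strongly convex on $C$ for some $\sigma>0$. 2. $f:\mathbb R^n\to(-\infty,+\infty]$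 is proper and lower semicontinuous, $\operatorname{dom}\phi\subset\operatorname{dom}f$, $f$ is $\mathcal C^1$ on $C$, and $\nabla f$ is Lipschitz continuous on every compact subset of $C$. 3. $g:\mathbb R^n\to(-\infty,+\infty]$ is proper, lower semicontinuous and convex with $C\subset\operatorname{dom}g$. 4. $\Psi=f+g$ is level-bounded (every set $\{\Psi\le r\}$, $r\in\mathbb R$, is bounded) and $\inf_{\operatorname{cl}C}\Psi>-\infty$. 5. For all $x\in C$, $\lambda>0$: $\big(\lambda g(u)+\frac12\langle\nabla^2\phi(x)(u-x),u-x\rangle\big)/\|u\|\to\infty$ as $\|u\|\to\infty$. 6. For all $x\in C$, $\lambda>0$: $\tilde{\mathcal T}_\lambda(x):=\operatorname{argmin}_{u\in\operatorname{cl}C}\{\langle\nabla f(x),u-x\rangle+g(u)+\frac1{2\lambda}\langle\nabla^2\phi(x)(u-x),u-x\rangle\}\subset C$. **Algorithm (ABPG-VMAW).** Fix $\lambda>0$ and $0<c_1<c_2<1$. Let $x^k\in C$, $y^k\in\tilde{\mathcal T}_\lambda(x^k)$, $d^k=y^k-x^k$, $\xi^k\in\partial g(x^k)$ and step-sizes $t_k>0$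 with $\sup_k t_k<\infty$ $(k=0,1,2,\dots)$ be such that, whenever $d^k\ne0$, both $A_k(t_k)<0$ and $W_k(t_k)>0$, where $$A_k(t)=\Psi(x^k+td^k)+\delta_{\operatorname{cl}C}(x^k+td^k)-\Psi(x^k)-c_1t\Big(\langle\nabla f(x^k),d^k\rangle+g(x^k+d^k)-g(x^k)+\tfrac1{2\lambda}\langle\nabla^2\phi(x^k)d^k,d^k\rangle\Big),$$ $$W_k(t)=\langle\nabla f(x^k+td^k)+\xi^k,d^k\rangle-c_2\langle\nabla f(x^k)+\xi^k,d^k\rangle,$$ and such that $x^{k+1}=y^k$ if $\Psi(y^k)<\Psi(x^k+t_kd^k)$ and $x^{k+1}=x^k+t_kd^k$ otherwise. (If $d^k=0$ the algorithm has stopped and $x^{k+1}=x^k$.) **KL assumption.** There is $\theta\in[0,1)$ such that for every $\tilde x\in\operatorname{dom}\partial\Psi$ there are $c>0$, $v\in(0,+\infty]$ and a neighbourhood $U$ of $\tilde x$ such that, with $\psi(s)=cs^{1-\theta}$, $$\psi'(\Psi(x)-\Psi(\tilde x))\,\operatorname{dist}(0,\partial\Psi(x))\ge1\quad\text{for all }x\in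 U\text{ with }\Psi(\tilde x)<\Psi(x)<\Psi(\tilde x)+v$$ (where $\operatorname{dist}(0,\emptyset)=+\infty$). **Theorem (Convergence rates).** The sequence $\{x^k\}$ has an accumulation point in $\operatorname{cl}C$. Let $\bar x$ be an accumulation point of $\{x^k\}$ with $\bar x\in C$ (automatic if $C=\mathbb R^n$). Then $\bar x$ is a stationary point, i.e. $0\in\nabla f(\bar x)+\partial(g+\delta_{\operatorname{cl}C})(\bar x)$, the whole sequence $\{x^k\}$ converges to $\bar x$, and: - (i) if $\theta=0$, then $x^k=\bar x$ for all sufficiently large $k$; - (ii) if $\theta\in(0,1/2]$, there are $a>0$ and $\eta\in[0,1)$ with $\|x^k-\bar x\|<a\,\eta^k$ for all $k\ge0$; - (iii) if $\theta\in(1/2,1)$, there is $b>0$ with $\|x^k-\bar x\|<b\,k^{-\frac{1-\theta}{2\theta-1}}$ for all $k\ge1$. -/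

import Mathlib

open Filter Topology

noncomputable section

namespace ABPG

/-- The space `ℝⁿ` with its Euclidean norm and inner product. -/
abbrev Rn (n : ℕ) : Type := EuclideanSpace ℝ (Fin n)

/-! ### Extended-real-valued functions -/

/-- The effective domain `{x | F x < +∞}`. -/
def effDom {n : ℕ} (F : Rn n → EReal) : Set (Rn n) := {x | F x < ⊤}

/-- `F` never takes the value `-∞` and is finite somewhere. -/
def Proper {n : ℕ} (F : Rn n → EReal) : Prop :=
  (∀ x, F x ≠ ⊥) ∧ (effDom F).Nonempty

/-- Convexity of a function with values in `(-∞, +∞]`. -/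
def ConvexFun {n : ℕ} (F : Rn n → EReal) : Prop :=
  ∀ x y : Rn n, ∀ a b : ℝ, 0 < a → 0 < b → a + b = 1 →
    F (a • x + b • y) ≤ (a : EReal) * F x + (b : EReal) * F y

/-- The indicator function `δ_S`: `0` on `S` and `+∞` elsewhere. -/
def indicatorFun {n : ℕ} (S : Set (Rn n)) (x : Rn n) : EReal :=
  open Classical in if x ∈ S then 0 else ⊤

/-- The gradient at `x` of an extended-real-valued function, computed from its real values
(meaningful where `F` is finite near `x` and differentiable at `x`). -/
def grad {n : ℕ} (F : Rn n → EReal) (x : Rn n) : Rn n :=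
  gradient (fun z => (F z).toReal) x

/-- The Hessian `∇²F(x)` as a linear operator, the derivative of the gradient. -/
def hess {n : ℕ} (F : Rn n → EReal) (x : Rn n) : Rn n →L[ℝ] Rn n :=
  fderiv ℝ (grad F) x

/-! ### Subdifferentials -/

/-- The regular subdifferential:
`liminf_{y → x, y ≠ x} (F y - F x - ⟨ξ, y - x⟩) / ‖x - y‖ ≥ 0`, for `x ∈ dom F`. -/
def regularSubdiff {n : ℕ} (F : Rn n → EReal) (x : Rn n) : Set (Rn n) :=
  {ξ | x ∈ effDom F ∧
    0 ≤ liminf (fun y : Rn n =>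
      (F y - F x - ((inner ℝ ξ (y - x) : ℝ) : EReal)) / ((‖x - y‖ : ℝ) : EReal)) (𝓝[≠] x)}

/-- The limiting subdifferential `∂F(x)`. -/
def subdiff {n : ℕ} (F : Rn n → EReal) (x : Rn n) : Set (Rn n) :=
  {ξ | x ∈ effDom F ∧ ∃ (xs ξs : ℕ → Rn n),
    Tendsto xs atTop (𝓝 x) ∧ Tendsto (fun k => F (xs k)) atTop (𝓝 (F x)) ∧
    Tendsto ξs atTop (𝓝 ξ) ∧ ∀ k, ξs k ∈ regularSubdiff F (xs k)}

/-- `dom ∂F`, the set of points with nonempty subdifferential. -/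
def domSubdiff {n : ℕ} (F : Rn n → EReal) : Set (Rn n) := {x | (subdiff F x).Nonempty}

/-! ### The Kurdyka–Łojasiewicz property -/

/-- The class `Ξ_v` of desingularizing functions on `[0, v)`, with `0 < v ≤ +∞`. -/
structure Desingularizer (v : EReal) (ψ : ℝ → ℝ) : Prop where
  continuousOn : ContinuousOn ψ {s : ℝ | 0 ≤ s ∧ (s : EReal) < v}
  concaveOn : ConcaveOn ℝ {s : ℝ | 0 ≤ s ∧ (s : EReal) < v} ψ
  nonneg : ∀ s : ℝ, 0 ≤ s → (s : EReal) < v → 0 ≤ ψ s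
  contDiffOn : ContDiffOn ℝ 1 ψ {s : ℝ | 0 < s ∧ (s : EReal) < v}
  map_zero : ψ 0 = 0
  deriv_pos : ∀ s : ℝ, 0 < s → (s : EReal) < v → 0 < deriv ψ s

/-- `F` satisfies the Kurdyka–Łojasiewicz property at `xb` with the function `ψ`: for some
`v ∈ (0, +∞]` with `ψ ∈ Ξ_v` and some neighbourhood `U` of `xb`, the inequality
`ψ'(F x - F xb) * dist(0, ∂F x) ≥ 1` holds for `x ∈ U` with `F xb < F x < F xb + v`.
The distance to the empty set is `+∞`. -/
def KLPropertyAt {n : ℕ} (F : Rn n → EReal) (ψ : ℝ → ℝ) (xb : Rn n) : Prop :=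
  ∃ v : EReal, 0 < v ∧ Desingularizer v ψ ∧ ∃ U ∈ 𝓝 xb, ∀ x ∈ U,
    F xb < F x → F x < F xb + v →
      1 ≤ ENNReal.ofReal (deriv ψ (F x - F xb).toReal) * Metric.infEDist 0 (subdiff F x)

/-- `F` is a KL function whose desingularizing functions have the form `ψ(s) = c s^(1-θ)`:
the exponent is the same at all points of `dom ∂F`, the constant `c > 0` may depend on the
point. -/
def IsKLFunctionWithExponent {n : ℕ} (F : Rn n → EReal) (θ : ℝ) : Prop :=
  ∀ xb ∈ domSubdiff F, ∃ c : ℝ, 0 < c ∧ KLPropertyAt F (fun s : ℝ => c * s ^ (1 - θ)) xb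

/-! ### The optimization problem -/

/-- `φ` is a kernel generating distance associated with `C`. -/
structure KernelGeneratingDistance {n : ℕ} (C : Set (Rn n)) (φ : Rn n → EReal) : Prop where
  proper : Proper φ
  lsc : LowerSemicontinuous φ
  convex : ConvexFun φ
  dom_subset : effDom φ ⊆ closure C
  dom_subdiff : domSubdiff φ = C
  interior_dom : interior (effDom φ) = C
  contDiffOn : ContDiffOn ℝ 1 (fun x => (φ x).toReal) C

/-- The objective function `Ψ = f + g`. -/
def objective {n : ℕ} (f g : Rn n → EReal) (x : Rn n) : EReal := f x + g x

/-- The approximate Bregman distance `½ ⟨∇²φ(x)(u - x), u - x⟩`. -/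
def approxBregman {n : ℕ} (φ : Rn n → EReal) (u x : Rn n) : ℝ :=
  (1 / 2) * inner ℝ (hess φ x (u - x)) (u - x)

/-- The assumptions on `φ`, `f` and `g`. -/
structure ProblemAssumptions {n : ℕ} (C : Set (Rn n)) (φ f g : Rn n → EReal) : Prop where
  kernel : KernelGeneratingDistance C φ
  closure_eq : closure C = closure (effDom φ)
  kernel_C2 : ContDiffOn ℝ 2 (fun x => (φ x).toReal) C
  f_proper : Proper f
  f_lsc : LowerSemicontinuous f
  dom_f : effDom φ ⊆ effDom f
  f_C1 : ContDiffOn ℝ 1 (fun x => (f x).toReal) C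
  g_proper : Proper g
  g_lsc : LowerSemicontinuous g
  g_convex : ConvexFun g
  dom_g : C ⊆ effDom g
  bddBelow : ⊥ < ⨅ x ∈ closure C, objective f g x
  supercoercive : ∀ x ∈ C, ∀ lam : ℝ, 0 < lam →
    Tendsto (fun u : Rn n =>
      ((lam : EReal) * g u + (approxBregman φ u x : EReal)) / ((‖u‖ : ℝ) : EReal))
      (Bornology.cobounded (Rn n)) (𝓝 ⊤)

/-- The objective of the subproblem,
`⟨∇f(x), u - x⟩ + g(u) + (1/lam) * ½ ⟨∇²φ(x)(u - x), u - x⟩`. -/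
def subproblem {n : ℕ} (φ f g : Rn n → EReal) (lam : ℝ) (x u : Rn n) : EReal :=
  ((inner ℝ (grad f x) (u - x) : ℝ) : EReal) + g u
    + (((1 / lam) * approxBregman φ u x : ℝ) : EReal)

/-- The approximate Bregman proximal gradient mapping: the set of minimizers over `cl C` of
the subproblem at `x`. -/
def approxProx {n : ℕ} (C : Set (Rn n)) (φ f g : Rn n → EReal) (lam : ℝ) (x : Rn n) :
    Set (Rn n) :=
  {y | y ∈ closure C ∧
    ∀ u ∈ closure C, subproblem φ f g lam x y ≤ subproblem φ f g lam x u}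

/-- The minimizers of all subproblems lie in `C`. -/
def Feasibility {n : ℕ} (C : Set (Rn n)) (φ f g : Rn n → EReal) : Prop :=
  ∀ x ∈ C, ∀ lam : ℝ, 0 < lam → approxProx C φ f g lam x ⊆ C

/-- All lower level sets of `F` are bounded. -/
def LevelBounded {n : ℕ} (F : Rn n → EReal) : Prop :=
  ∀ r : ℝ, Bornology.IsBounded {x | F x ≤ (r : EReal)}

/-- `∇f` is Lipschitz continuous on compact sets (inside `C`, where `f` is differentiable). -/
def LocallyLipschitzGrad {n : ℕ} (C : Set (Rn n)) (f : Rn n → EReal) : Prop :=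
  ∀ K : Set (Rn n), IsCompact K → K ⊆ C → ∃ L : NNReal, LipschitzOnWith L (grad f) K

/-- `0 ∈ ∇f(x) + ∂(g + δ_{cl C})(x)`. -/
def IsStationary {n : ℕ} (C : Set (Rn n)) (f g : Rn n → EReal) (x : Rn n) : Prop :=
  ∃ w ∈ subdiff (fun u => g u + indicatorFun (closure C) u) x, grad f x + w = 0

/-! ### The algorithm -/

/-- The Armijo-type function `A(t)` at the point `x` with search direction `d`:
`Ψ(x + t d) + δ_{cl C}(x + t d) - Ψ(x)
  - c₁ t (⟨∇f(x), d⟩ + g(x + d) - g(x) + (1/(2 lam)) ⟨∇²φ(x) d, d⟩)`. -/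
def armijo {n : ℕ} (C : Set (Rn n)) (φ f g : Rn n → EReal) (lam c₁ : ℝ) (x d : Rn n)
    (t : ℝ) : EReal :=
  objective f g (x + t • d) + indicatorFun (closure C) (x + t • d) - objective f g x
    - ((c₁ * t : ℝ) : EReal) *
      (((inner ℝ (grad f x) d : ℝ) : EReal) + g (x + d) - g x
        + ((1 / (2 * lam) * inner ℝ (hess φ x d) d : ℝ) : EReal))

/-- The Wolfe-type function `W(t) = ⟨∇f(x + t d) + ξ, d⟩ - c₂ ⟨∇f(x) + ξ, d⟩`. -/
def wolfe {n : ℕ} (f : Rn n → EReal) (c₂ : ℝ) (x d ξ : Rn n) (t : ℝ) : ℝ :=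
  inner ℝ (grad f (x + t • d) + ξ) d - c₂ * inner ℝ (grad f x + ξ) d

/-- The sequences `x`, `y`, `ξ`, `t` are generated by the approximate Bregman proximal gradient
algorithm with variable metric Armijo–Wolfe line search. If `d k = y k - x k` vanishes, the
algorithm has stopped: the update rule then gives `x (k + 1) = x k`, and nothing is required of
the (unused) step-size `t k > 0`. -/
structure GeneratedByABPG {n : ℕ} (C : Set (Rn n)) (φ f g : Rn n → EReal)
    (lam c₁ c₂ : ℝ) (x y ξ : ℕ → Rn n) (t : ℕ → ℝ) : Prop where
  mem : ∀ k, x k ∈ C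
  sub_mem : ∀ k, y k ∈ approxProx C φ f g lam (x k)
  subgrad : ∀ k, ξ k ∈ subdiff g (x k)
  step_pos : ∀ k, 0 < t k
  armijo_neg : ∀ k, y k - x k ≠ 0 → armijo C φ f g lam c₁ (x k) (y k - x k) (t k) < 0
  wolfe_pos : ∀ k, y k - x k ≠ 0 → 0 < wolfe f c₂ (x k) (y k - x k) (ξ k) (t k)
  update_sub : ∀ k, objective f g (y k) < objective f g (x k + t k • (y k - x k)) →
    x (k + 1) = y k
  update_line : ∀ k, ¬ objective f g (y k) < objective f g (x k + t k • (y k - x k)) →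
    x (k + 1) = x k + t k • (y k - x k)

end ABPG

end

/-!
The proof separates the algorithm from an abstract convergence mechanism.

The abstract part (`LojasiewiczDescent`) concerns iterates `x k`, lengths `d k` with
`‖x (k + 1) - x k‖ ≤ τ d k`, and objective gaps `Δ k` decreasing to zero such that, near an
accumulation point, `a d k ^ 2 ≤ Δ k - Δ (k + 1)` and `Δ (k + 1) ^ θ ≤ c d k` as long as
`Δ (k + 1) > 0`. By concavity of `s ↦ s ^ (1 - θ)` and the inequality of arithmetic and geometric
means, the Lyapunov function `d k + D Δ (k + 1) ^ (1 - θ)` decreases by at least `d (k + 1)`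
(`length_succ_le`). So it bounds the length of the remaining path: the iterates cannot leave the
neighbourhood again (`eventually_mem_ball`), they converge, and the distance to the limit is of
order `Δ k ^ min (1 / 2) (1 - θ)`. The recursion `Δ (k + 1) ^ (2 θ) ≤ A (Δ k - Δ (k + 1))` then
gives the rates: geometric decay for `θ ≤ 1 / 2`, and linear growth of `Δ k ^ (1 - 2 θ)` for
`θ > 1 / 2` (`exists_mul_rpow_le_one`); for `θ = 0` the gap vanishes after finitely many steps.

For the algorithm, the first-order condition of the subproblem says that `proxSubgrad` satisfies
the subgradient inequality of `g` at `y k`. Tested at `x k`, and combined with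
`⟨∇²φ(x) d, d⟩ ≥ σ ‖d‖ ^ 2`, it makes the search direction one of descent, and the Armijo
condition yields a decrease of order `t k ‖d k‖ ^ 2` (`Run.descent`). The Wolfe condition bounds
`t k` below near an accumulation point in `C` (`Run.exists_quadratic_decrease`), where `∇f` is
Lipschitz. Hence `d k` tends to zero along the subsequence, which gives stationarity, and
`∇f(y k) + proxSubgrad` is a subgradient of the objective of norm `O(‖d k‖)`. The
Kurdyka–Łojasiewicz inequality is applied at `y k`; since the update never does worse than `y k`,
it controls the gap at `x (k + 1)`.
-/

namespace ABPG

/-! ### Real sequences -/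

theorem exists_pos_forall_lt_mul {r w : ℕ → ℝ} {B : ℝ} (hw : ∀ k, 0 < w k)
    (h : ∀ᶠ k in atTop, r k ≤ B * w k) : ∃ b : ℝ, 0 < b ∧ ∀ k, r k < b * w k := by
  have hbdd : BddAbove (Set.range fun k => r k / w k) := by
    refine Filter.IsBoundedUnder.bddAbove_range ⟨B, ?_⟩
    rw [eventually_map]
    filter_upwards [h] with k hk
    exact (div_le_iff₀ (hw k)).2 hk
  obtain ⟨b, hb⟩ := hbdd
  refine ⟨max b 0 + 1, by positivity, fun k => ?_⟩
  have h1 : r k / w k ≤ b := hb ⟨k, rfl⟩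
  rw [← div_lt_iff₀ (hw k)]
  linarith [le_max_left b 0]

/-- The tangent-line inequality for the concave function `s ↦ s ^ (1 - θ)`, multiplied by
`s ^ θ`. -/
theorem one_sub_mul_sub_le_rpow_mul {θ s s' : ℝ} (hθ₀ : 0 ≤ θ) (hθ₁ : θ < 1) (hs : 0 < s)
    (hs' : 0 ≤ s') :
    (1 - θ) * (s - s') ≤ s ^ θ * (s ^ (1 - θ) - s' ^ (1 - θ)) := by
  have h1 := Real.geom_mean_le_arith_mean2_weighted hθ₀ (by linarith : 0 ≤ 1 - θ) hs.le hs'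
    (by ring)
  have h2 : s ^ θ * s ^ (1 - θ) = s := by
    rw [← Real.rpow_add hs]; simp
  rw [mul_sub (s ^ θ), h2]
  linarith

theorem le_geometric_of_le {Δ : ℕ → ℝ} {q : ℝ} {K : ℕ} (hq : 0 ≤ q)
    (h : ∀ k ≥ K, Δ (k + 1) ≤ q * Δ k) (j : ℕ) : Δ (K + j) ≤ q ^ j * Δ K := by
  induction j with
  | zero => simp
  | succ j ih =>
    calc Δ (K + (j + 1)) ≤ q * Δ (K + j) := h (K + j) (by omega)
      _ ≤ q * (q ^ j * Δ K) := by gcongr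
      _ = q ^ (j + 1) * Δ K := by ring

/-- A nonnegative sequence with `Δ (k + 1) ^ (1 + p) ≤ A * (Δ k - Δ (k + 1))` tends to zero like
`k ^ (-1 / p)`: the sequence `Δ k ^ (-p)` grows at least linearly. -/
theorem exists_mul_rpow_le_one {Δ : ℕ → ℝ} {p A : ℝ} {K : ℕ} (hp : 0 < p)
    (hA : 0 < A) (hΔ : ∀ k, 0 ≤ Δ k) (hant : Antitone Δ) (hlim : Tendsto Δ atTop (𝓝 0))
    (h : ∀ k ≥ K, 0 < Δ (k + 1) → Δ (k + 1) ^ (1 + p) ≤ A * (Δ k - Δ (k + 1))) :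
    ∃ μ : ℝ, 0 < μ ∧ ∃ N : ℕ, ∀ j : ℕ, μ * j * Δ (N + j) ^ p ≤ 1 := by
  have hUlim : Tendsto (fun k => Δ k ^ p) atTop (𝓝 0) := by
    have := hlim.rpow_const (p := p) (Or.inr hp.le)
    rwa [Real.zero_rpow hp.ne'] at this
  -- `Δ k ≥ Δ (k + 1) (1 + U / A)` with `U = Δ (k + 1) ^ p`; raising to the power `p` and using
  -- `log (1 + w) ≥ w / 2` for `w ≤ 1` gives `Δ k ^ p ≥ U (1 + ν U)`
  set ν := p / (2 * A) with hν
  have hνpos : 0 < ν := by positivity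
  have hev : ∀ᶠ k in atTop, Δ k ^ p ≤ A ∧ ν * Δ k ^ p ≤ 1 := by
    have h1 := hUlim.eventually_le_const hA
    have h2 := (hUlim.const_mul ν).eventually_le_const (u := 1) (by simp)
    exact h1.and h2
  obtain ⟨N₀, hN₀⟩ := eventually_atTop.1 hev
  set N := max K N₀
  refine ⟨ν / 2, by positivity, N, fun j => ?_⟩
  induction j with
  | zero => simp
  | succ j ih =>
    set k := N + j with hk
    have hkK : K ≤ k := by have := le_max_left K N₀; omega
    have hkN : N₀ ≤ k + 1 := by have := le_max_right K N₀; omega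
    rw [show N + (j + 1) = k + 1 by omega]
    rcases (hΔ (k + 1)).eq_or_lt with h0 | hpos
    · rw [← h0, Real.zero_rpow hp.ne']; simp
    obtain ⟨hUA, hνU⟩ := hN₀ (k + 1) hkN
    set U := Δ (k + 1) ^ p with hU
    have hUpos : 0 < U := Real.rpow_pos_of_pos hpos p
    have hkpos : 0 < Δ k := hpos.trans_le (hant (Nat.le_succ k))
    set w := U / A with hw
    have hwpos : 0 < w := by positivity
    have hw1 : w ≤ 1 := (div_le_one hA).2 hUA
    have h1 : Δ (k + 1) * (1 + w) ≤ Δ k := by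
      have h2 := h k hkK hpos
      rw [Real.rpow_add hpos, Real.rpow_one] at h2
      have h3 : Δ (k + 1) * w = Δ (k + 1) * U / A := by rw [hw]; ring
      have h4 : Δ (k + 1) * U / A ≤ Δ k - Δ (k + 1) := by
        rw [div_le_iff₀ hA]; linarith
      linarith
    have h2 : U * (1 + ν * U) ≤ Δ k ^ p := by
      have h3 : 1 + p * (w / 2) ≤ (1 + w) ^ p := by
        have hlog : w / 2 ≤ Real.log (1 + w) := by
          have h5 := Real.one_sub_inv_le_log_of_pos (by linarith : 0 < 1 + w)
          refine le_trans ?_ h5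
          have : (1 + w)⁻¹ = 1 - w / (1 + w) := by field_simp; ring
          rw [this]
          have : w / 2 ≤ w / (1 + w) := by gcongr; linarith
          linarith
        calc 1 + p * (w / 2) ≤ p * Real.log (1 + w) + 1 := by nlinarith
          _ ≤ Real.exp (p * Real.log (1 + w)) := Real.add_one_le_exp _
          _ = (1 + w) ^ p := by
            rw [Real.rpow_def_of_pos (by linarith)]; ring_nf
      have h4 : ν * U = p * (w / 2) := by rw [hν, hw]; field_simp
      calc U * (1 + ν * U) ≤ U * (1 + w) ^ p := by rw [h4]; gcongr
        _ = (Δ (k + 1) * (1 + w)) ^ p := by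
          rw [Real.mul_rpow hpos.le (by linarith)]
        _ ≤ Δ k ^ p := by
          apply Real.rpow_le_rpow (by positivity) h1 hp.le
    have h3 : ν / 2 * j * (U * (1 + ν * U)) ≤ 1 :=
      (mul_le_mul_of_nonneg_left h2 (by positivity)).trans ih
    push_cast
    have h5 : ν / 2 * U * (1 + ν * U) ≤ ν * U := by nlinarith [mul_pos hνpos hUpos]
    have h6 : (ν / 2 * (j + 1) * U) * (1 + ν * U) ≤ 1 * (1 + ν * U) := by nlinarith
    exact le_of_mul_le_mul_right h6 (by positivity)

/-! ### Descent sequences under a Łojasiewicz inequality -/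

/-- The quantitative properties of a descent method from which convergence to `xb` and its rate
follow: `x` is the sequence of iterates, `d k` the length of the `k`-th search direction and `Δ k`
the gap in objective value. The decrease and the Łojasiewicz inequality are required only at
indices `k ≥ K` with `x k` in the ball of radius `ρ` around `xb`. -/
structure LojasiewiczDescent {E : Type*} [NormedAddCommGroup E] (x : ℕ → E) (d Δ : ℕ → ℝ)
    (xb : E) (ρ a τ c θ : ℝ) (K : ℕ) : Prop where
  radius_pos : 0 < ρ
  a_pos : 0 < a
  τ_pos : 0 < τ
  c_pos : 0 < c
  θ_nonneg : 0 ≤ θ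
  θ_lt_one : θ < 1
  length_nonneg : ∀ k, 0 ≤ d k
  gap_nonneg : ∀ k, 0 ≤ Δ k
  gap_antitone : Antitone Δ
  gap_tendsto : Tendsto Δ atTop (𝓝 0)
  cluster : MapClusterPt xb atTop x
  step_le : ∀ k, ‖x (k + 1) - x k‖ ≤ τ * d k
  decrease : ∀ k ≥ K, x k ∈ Metric.ball xb ρ → a * d k ^ 2 ≤ Δ k - Δ (k + 1)
  lojasiewicz : ∀ k ≥ K, x k ∈ Metric.ball xb ρ → 0 < Δ (k + 1) → Δ (k + 1) ^ θ ≤ c * d k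

namespace LojasiewiczDescent

/-- The Lyapunov function `d k + D * Δ (k + 1) ^ (1 - θ)`, where `D = c / (a (1 - θ))`. -/
noncomputable def energy (d Δ : ℕ → ℝ) (a c θ : ℝ) (k : ℕ) : ℝ :=
  d k + c / (a * (1 - θ)) * Δ (k + 1) ^ (1 - θ)

variable {E : Type*} [NormedAddCommGroup E] {x : ℕ → E} {d Δ : ℕ → ℝ} {xb : E}
  {ρ a τ c θ : ℝ} {K : ℕ}

theorem energy_nonneg (h : LojasiewiczDescent x d Δ xb ρ a τ c θ K) (k : ℕ) :
    0 ≤ energy d Δ a c θ k := by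
  have h1 := h.length_nonneg k
  have h2 := Real.rpow_nonneg (h.gap_nonneg (k + 1)) (1 - θ)
  have h3 : 0 < a * (1 - θ) := mul_pos h.a_pos (by linarith [h.θ_lt_one])
  have h4 := h.c_pos
  unfold energy
  positivity

theorem length_le_sqrt (h : LojasiewiczDescent x d Δ xb ρ a τ c θ K) {k : ℕ} (hk : K ≤ k)
    (hx : x k ∈ Metric.ball xb ρ) : d k ≤ √(Δ k / a) := by
  apply Real.le_sqrt_of_sq_le
  rw [le_div_iff₀ h.a_pos]
  linarith [h.decrease k hk hx, h.gap_nonneg (k + 1)]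

theorem tendsto_sqrt_gap (h : LojasiewiczDescent x d Δ xb ρ a τ c θ K) :
    Tendsto (fun k => √(Δ k / a)) atTop (𝓝 0) := by
  simpa using (h.gap_tendsto.div_const a).sqrt

theorem tendsto_gap_rpow (h : LojasiewiczDescent x d Δ xb ρ a τ c θ K) :
    Tendsto (fun k => c / (a * (1 - θ)) * Δ (k + 1) ^ (1 - θ)) atTop (𝓝 0) := by
  have hθ : 0 < 1 - θ := by linarith [h.θ_lt_one]
  have h1 := ((tendsto_add_atTop_iff_nat 1).2 h.gap_tendsto).rpow_const (p := 1 - θ)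
    (Or.inr hθ.le)
  rw [Real.zero_rpow hθ.ne'] at h1
  simpa using h1.const_mul (c / (a * (1 - θ)))

/-- The decrease `a d²` of the gap is at most a multiple of `d k` times the decrease of
`Δ ^ (1 - θ)`; the inequality of arithmetic and geometric means turns this into a decrease of the
Lyapunov function that controls the next step. -/
theorem length_succ_le (h : LojasiewiczDescent x d Δ xb ρ a τ c θ K) {k : ℕ} (hk : K ≤ k)
    (hx : x k ∈ Metric.ball xb ρ) (hx' : x (k + 1) ∈ Metric.ball xb ρ) :
    d (k + 1) ≤ energy d Δ a c θ k - energy d Δ a c θ (k + 1) := by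
  have ha := h.a_pos
  have hc := h.c_pos
  have hθ : 0 < 1 - θ := by linarith [h.θ_lt_one]
  have hdk := h.length_nonneg k
  have hdk' := h.length_nonneg (k + 1)
  have hdec := h.decrease (k + 1) (by omega) hx'
  unfold energy
  set D := c / (a * (1 - θ)) with hD
  rcases (h.gap_nonneg (k + 1)).eq_or_lt with h0 | hpos
  · have h2 := h.gap_nonneg (k + 1 + 1)
    have h3 : Δ (k + 1 + 1) = 0 := by nlinarith
    have h4 : d (k + 1) = 0 := by
      have : d (k + 1) ^ 2 ≤ 0 := by nlinarith
      nlinarith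
    rw [← h0, h3, h4]
    linarith
  · set S := Δ (k + 1) ^ (1 - θ) - Δ (k + 1 + 1) ^ (1 - θ) with hS
    have hS0 : 0 ≤ S := sub_nonneg.2
      (Real.rpow_le_rpow (h.gap_nonneg _) (h.gap_antitone (Nat.le_succ _)) hθ.le)
    have h1 := one_sub_mul_sub_le_rpow_mul h.θ_nonneg h.θ_lt_one hpos (h.gap_nonneg (k + 1 + 1))
    have h2 := h.lojasiewicz k hk hx hpos
    have h3 : (1 - θ) * (a * d (k + 1) ^ 2) ≤ c * d k * S :=
      calc (1 - θ) * (a * d (k + 1) ^ 2) ≤ (1 - θ) * (Δ (k + 1) - Δ (k + 1 + 1)) := by gcongr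
        _ ≤ Δ (k + 1) ^ θ * S := h1
        _ ≤ c * d k * S := by gcongr
    have h4 : d (k + 1) ^ 2 ≤ d k * (D * S) := by
      have : d k * (D * S) = c * d k * S / (a * (1 - θ)) := by rw [hD]; ring
      rw [this, le_div_iff₀ (by positivity)]
      linarith
    have hDS : 0 ≤ D * S := by positivity
    have h5 : 2 * d (k + 1) ≤ d k + D * S := by
      apply abs_le_of_sq_le_sq' _ (by positivity) |>.2
      nlinarith [sq_nonneg (d k - D * S)]
    have h6 : D * S = D * Δ (k + 1) ^ (1 - θ) - D * Δ (k + 1 + 1) ^ (1 - θ) := by rw [hS]; ring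
    linarith

/-- Once an iterate is close to `xb` and the Lyapunov function is small, all later iterates stay
in the ball, since the Lyapunov function bounds the length of the remaining path. -/
theorem eventually_mem_ball (h : LojasiewiczDescent x d Δ xb ρ a τ c θ K) :
    ∃ N ≥ K, ∀ k ≥ N, x k ∈ Metric.ball xb ρ := by
  have hτ := h.τ_pos
  have hθ : 0 < 1 - θ := by linarith [h.θ_lt_one]
  have hsqrt := h.tendsto_sqrt_gap
  have hpow := h.tendsto_gap_rpow
  have hsmall : Tendsto (fun k => τ * (√(Δ k / a) + (√(Δ k / a)
      + c / (a * (1 - θ)) * Δ (k + 1) ^ (1 - θ)))) atTop (𝓝 0) := by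
    simpa using (hsqrt.add (hsqrt.add hpow)).const_mul τ
  have hev := (hsmall.eventually_lt_const (half_pos h.radius_pos)).and (eventually_ge_atTop K)
  have hfr := h.cluster.frequently (Metric.ball_mem_nhds xb (half_pos h.radius_pos))
  obtain ⟨N, hxN, hN, hNK⟩ := (hfr.and_eventually hev).exists
  have hxN' : x N ∈ Metric.ball xb ρ :=
    Metric.ball_subset_ball (by linarith [h.radius_pos]) hxN
  have hdN := h.length_le_sqrt hNK hxN'
  set e := energy d Δ a c θ with he
  have hbound : τ * (d N + e N) < ρ / 2 := by
    refine lt_of_le_of_lt ?_ hN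
    have : e N ≤ √(Δ N / a) + c / (a * (1 - θ)) * Δ (N + 1) ^ (1 - θ) := by
      simp only [he, energy]; gcongr
    gcongr
  have key : ∀ j, x (N + j) ∈ Metric.ball xb ρ ∧
      ‖x (N + j + 1) - x N‖ ≤ τ * (d N + e N - e (N + j)) := by
    intro j
    induction j with
    | zero => exact ⟨hxN', by simpa using h.step_le N⟩
    | succ j ih =>
      obtain ⟨ih1, ih2⟩ := ih
      have hmem : x (N + j + 1) ∈ Metric.ball xb ρ := by
        rw [dist_eq_norm] at hxN
        rw [Metric.mem_ball, dist_eq_norm]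
        have h1 : ‖x (N + j + 1) - xb‖ ≤ ‖x (N + j + 1) - x N‖ + ‖x N - xb‖ :=
          norm_sub_le_norm_sub_add_norm_sub _ _ _
        have h2 : 0 ≤ τ * e (N + j) := mul_nonneg hτ.le (h.energy_nonneg _)
        nlinarith
      refine ⟨hmem, ?_⟩
      have h1 := h.length_succ_le (by omega : K ≤ N + j) ih1 hmem
      have h2 := h.step_le (N + j + 1)
      have h3 : ‖x (N + j + 1 + 1) - x N‖ ≤ ‖x (N + j + 1 + 1) - x (N + j + 1)‖
          + ‖x (N + j + 1) - x N‖ := norm_sub_le_norm_sub_add_norm_sub _ _ _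
      have h4 := mul_le_mul_of_nonneg_left h1 hτ.le
      rw [← he] at h4
      rw [show N + (j + 1) = N + j + 1 by omega]
      linarith
  refine ⟨N, hNK, fun k hk => ?_⟩
  have := (key (k - N)).1
  rwa [show N + (k - N) = k by omega] at this

/-- The iterates converge to `xb`, and the Lyapunov function bounds the remaining distance. -/
theorem exists_norm_sub_le (h : LojasiewiczDescent x d Δ xb ρ a τ c θ K) :
    Tendsto x atTop (𝓝 xb) ∧ ∃ N ≥ K, (∀ k ≥ N, x k ∈ Metric.ball xb ρ) ∧
      ∀ k ≥ N, ‖x (k + 1) - xb‖ ≤ τ * energy d Δ a c θ k := by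
  obtain ⟨N, hNK, hN⟩ := h.eventually_mem_ball
  have hτ := h.τ_pos
  set e := energy d Δ a c θ with he
  have hpath : ∀ k ≥ N, ∀ j, ‖x (k + 1 + j) - x (k + 1)‖ ≤ τ * (e k - e (k + j)) := by
    intro k hk j
    induction j with
    | zero => simp
    | succ j ih =>
      have h1 := h.length_succ_le (by omega : K ≤ k + j) (hN _ (by omega)) (hN _ (by omega))
      have h2 := h.step_le (k + 1 + j)
      have h3 : ‖x (k + 1 + j + 1) - x (k + 1)‖ ≤ ‖x (k + 1 + j + 1) - x (k + 1 + j)‖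
          + ‖x (k + 1 + j) - x (k + 1)‖ := norm_sub_le_norm_sub_add_norm_sub _ _ _
      have h4 := mul_le_mul_of_nonneg_left h1 hτ.le
      rw [← he] at h4
      rw [show k + 1 + (j + 1) = k + 1 + j + 1 by omega, show k + (j + 1) = k + j + 1 by omega]
      rw [show k + 1 + j = k + j + 1 by omega] at *
      linarith
  have hbound : ∀ k ≥ N, ‖x (k + 1) - xb‖ ≤ τ * e k := by
    intro k hk
    refine le_of_forall_pos_lt_add fun ε hε => ?_
    have hfr := (h.cluster.frequently (Metric.ball_mem_nhds xb hε)).and_eventually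
      (eventually_ge_atTop (k + 1))
    obtain ⟨m, hm, hmk⟩ := hfr.exists
    have h1 := hpath k hk (m - (k + 1))
    rw [show k + 1 + (m - (k + 1)) = m by omega] at h1
    rw [dist_eq_norm] at hm
    have h2 : ‖x (k + 1) - xb‖ ≤ ‖x (k + 1) - x m‖ + ‖x m - xb‖ :=
      norm_sub_le_norm_sub_add_norm_sub _ _ _
    rw [norm_sub_rev (x (k + 1)) (x m)] at h2
    have h3 : 0 ≤ τ * e (k + (m - (k + 1))) := mul_nonneg hτ.le (h.energy_nonneg _)
    nlinarith
  refine ⟨?_, N, hNK, hN, hbound⟩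
  have hθ : 0 < 1 - θ := by linarith [h.θ_lt_one]
  have hsqrt := h.tendsto_sqrt_gap
  have hpow := h.tendsto_gap_rpow
  have hsmall : Tendsto (fun k => τ * (√(Δ k / a)
      + c / (a * (1 - θ)) * Δ (k + 1) ^ (1 - θ))) atTop (𝓝 0) := by
    simpa using (hsqrt.add hpow).const_mul τ
  rw [← tendsto_add_atTop_iff_nat 1, tendsto_iff_norm_sub_tendsto_zero]
  refine squeeze_zero' (.of_forall fun _ => norm_nonneg _) ?_ hsmall
  filter_upwards [eventually_ge_atTop N] with k hk
  refine (hbound k hk).trans ?_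
  have h1 := h.length_le_sqrt (hNK.trans hk) (hN k hk)
  simp only [he, energy]
  gcongr

theorem eventually_eq (h : LojasiewiczDescent x d Δ xb ρ a τ c θ K) (hθ : θ = 0) :
    ∃ N : ℕ, ∀ k ≥ N, x k = xb := by
  obtain ⟨-, N, hNK, hN, hbound⟩ := h.exists_norm_sub_le
  have hc := h.c_pos
  have hsqrt : Tendsto (fun k => c * √(Δ k / a)) atTop (𝓝 0) := by
    simpa using h.tendsto_sqrt_gap.const_mul c
  obtain ⟨M, hM⟩ := eventually_atTop.1 (hsqrt.eventually_lt_const one_pos)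
  have hzero : ∀ k ≥ max N M, Δ (k + 1) = 0 := by
    intro k hk
    have hkN : N ≤ k := (le_max_left _ _).trans hk
    by_contra hne
    have hpos := (h.gap_nonneg (k + 1)).lt_of_ne' hne
    have h1 := h.lojasiewicz k (hNK.trans hkN) (hN k hkN) hpos
    rw [hθ, Real.rpow_zero] at h1
    have h2 := mul_le_mul_of_nonneg_left (h.length_le_sqrt (hNK.trans hkN) (hN k hkN)) hc.le
    linarith [hM k ((le_max_right _ _).trans hk)]
  refine ⟨max N M + 2, fun k hk => ?_⟩
  obtain ⟨m, rfl⟩ : ∃ m, k = m + 1 + 1 := ⟨k - 2, by omega⟩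
  have hm : max N M ≤ m := by omega
  have hmN : N ≤ m + 1 := by have := le_max_left N M; omega
  have h1 := h.length_le_sqrt (hNK.trans hmN) (hN _ hmN)
  rw [hzero m hm, zero_div, Real.sqrt_zero] at h1
  have h2 := hbound (m + 1) hmN
  have h3 : energy d Δ a c θ (m + 1) ≤ 0 := by
    rw [energy, hzero (m + 1) (by omega), hθ]; simpa using h1
  have h4 : ‖x (m + 1 + 1) - xb‖ ≤ 0 := h2.trans (mul_nonpos_of_nonneg_of_nonpos h.τ_pos.le h3)
  exact sub_eq_zero.1 (norm_le_zero_iff.1 h4)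

/-- The distance to the limit is bounded by the power of the gap with the smaller of the two
exponents `1 / 2` and `1 - θ`. -/
theorem exists_norm_sub_le_rpow (h : LojasiewiczDescent x d Δ xb ρ a τ c θ K) {s : ℝ}
    (hs : 0 < s) (hs₁ : s ≤ 1 / 2) (hs₂ : s ≤ 1 - θ) :
    ∃ B : ℝ, 0 < B ∧ ∀ᶠ k in atTop, ‖x (k + 1) - xb‖ ≤ B * Δ k ^ s := by
  obtain ⟨-, N, hNK, hN, hbound⟩ := h.exists_norm_sub_le
  have ha := h.a_pos
  have hc := h.c_pos
  have hτ := h.τ_pos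
  have hθ : 0 < 1 - θ := by linarith [h.θ_lt_one]
  refine ⟨τ * ((√a)⁻¹ + c / (a * (1 - θ))), by positivity, ?_⟩
  filter_upwards [eventually_ge_atTop N, h.gap_tendsto.eventually_le_const one_pos] with k hk hk1
  refine (hbound k hk).trans ?_
  rw [mul_assoc]
  gcongr
  rw [energy, add_mul]
  have hmono : ∀ r, s ≤ r → Δ k ^ r ≤ Δ k ^ s := fun r hr =>
    Real.rpow_le_rpow_of_exponent_ge_of_imp (h.gap_nonneg k) hk1 hr (fun _ h0 => absurd h0 (by linarith))
  gcongr
  · refine (h.length_le_sqrt (hNK.trans hk) (hN k hk)).trans ?_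
    rw [Real.sqrt_div (h.gap_nonneg k), div_eq_inv_mul]
    refine mul_le_mul_of_nonneg_left ?_ (by positivity)
    rw [Real.sqrt_eq_rpow]
    exact hmono _ hs₁
  · exact (Real.rpow_le_rpow (h.gap_nonneg _) (h.gap_antitone (Nat.le_succ k)) hθ.le).trans
      (hmono _ hs₂)

/-- Decrease and Łojasiewicz inequality combine to a recursion for the gap alone. -/
theorem gap_rpow_le (h : LojasiewiczDescent x d Δ xb ρ a τ c θ K) {k : ℕ} (hk : K ≤ k)
    (hx : x k ∈ Metric.ball xb ρ) (hpos : 0 < Δ (k + 1)) :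
    Δ (k + 1) ^ (2 * θ) ≤ c ^ 2 / a * (Δ k - Δ (k + 1)) := by
  have ha := h.a_pos
  have h1 := h.lojasiewicz k hk hx hpos
  have h2 := h.decrease k hk hx
  calc Δ (k + 1) ^ (2 * θ) = (Δ (k + 1) ^ θ) ^ 2 := by
        rw [mul_comm, Real.rpow_mul hpos.le, Real.rpow_two]
    _ ≤ (c * d k) ^ 2 := by gcongr
    _ = c ^ 2 / a * (a * d k ^ 2) := by field_simp
    _ ≤ _ := by gcongr

theorem exists_norm_sub_lt_geometric (h : LojasiewiczDescent x d Δ xb ρ a τ c θ K)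
    (hθ : θ ≤ 1 / 2) :
    ∃ b η : ℝ, 0 < b ∧ 0 ≤ η ∧ η < 1 ∧ ∀ k : ℕ, ‖x k - xb‖ < b * η ^ k := by
  obtain ⟨N, hNK, hN⟩ := h.eventually_mem_ball
  obtain ⟨B, hB, hBev⟩ := h.exists_norm_sub_le_rpow (s := 1 / 2) (by norm_num) le_rfl
    (by linarith)
  have ha := h.a_pos
  have hc := h.c_pos
  set A := c ^ 2 / a with hA
  have hApos : 0 < A := by positivity
  obtain ⟨M, hM⟩ := eventually_atTop.1 (h.gap_tendsto.eventually_le_const one_pos)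
  set q := A / (1 + A) with hq
  have hqpos : 0 < q := by positivity
  have hq1 : q < 1 := by rw [hq, div_lt_one (by positivity)]; linarith
  have hrec : ∀ k ≥ max N M, Δ (k + 1) ≤ q * Δ k := by
    intro k hk
    have hkN : N ≤ k := (le_max_left _ _).trans hk
    rcases (h.gap_nonneg (k + 1)).eq_or_lt with h0 | hpos
    · rw [← h0]; exact mul_nonneg hqpos.le (h.gap_nonneg k)
    have h1 := h.gap_rpow_le (hNK.trans hkN) (hN k hkN) hpos
    have h2 : Δ (k + 1) ≤ Δ (k + 1) ^ (2 * θ) :=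
      Real.self_le_rpow_of_le_one hpos.le (hM _ (by have := le_max_right N M; omega))
        (by linarith)
    rw [hq, div_mul_eq_mul_div, le_div_iff₀ (by positivity)]
    linarith
  set P := max N M
  have hsq : 0 < √q := Real.sqrt_pos.2 hqpos
  obtain ⟨b, hb, hlt⟩ := exists_pos_forall_lt_mul (r := fun k => ‖x k - xb‖)
    (w := fun k => √q ^ k) (B := B * √(Δ P) / √q ^ (P + 1)) (fun k => by positivity) (by
      filter_upwards [(tendsto_sub_atTop_nat 1).eventually hBev,
        eventually_ge_atTop (P + 1)] with k hk hkP
      obtain ⟨j, rfl⟩ : ∃ j, k = P + j + 1 := ⟨k - (P + 1), by omega⟩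
      rw [show P + j + 1 - 1 = P + j by omega] at hk
      refine hk.trans ?_
      have h1 := le_geometric_of_le hqpos.le hrec j
      have h2 : Δ (P + j) ^ (1 / 2 : ℝ) ≤ √q ^ j * √(Δ P) := by
        rw [← Real.sqrt_eq_rpow]
        refine (Real.sqrt_le_sqrt h1).trans ?_
        have h3 : √(q ^ j) = √q ^ j := by
          rw [Real.sqrt_eq_iff_eq_sq (by positivity) (by positivity), ← pow_mul, mul_comm j,
            pow_mul, Real.sq_sqrt hqpos.le]
        rw [Real.sqrt_mul (by positivity), h3]
      calc B * Δ (P + j) ^ (1 / 2 : ℝ) ≤ B * (√q ^ j * √(Δ P)) := by gcongr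
        _ = B * √(Δ P) / √q ^ (P + 1) * √q ^ (P + j + 1) := by
          rw [show P + j + 1 = (P + 1) + j by omega]
          have h3 : √q ^ (P + 1) ≠ 0 := by positivity
          field_simp
          ring)
  refine ⟨b, √q, hb, hsq.le, ?_, hlt⟩
  rw [Real.sqrt_lt' one_pos]; simpa using hq1

theorem exists_norm_sub_lt_rpow (h : LojasiewiczDescent x d Δ xb ρ a τ c θ K)
    (hθ : 1 / 2 < θ) :
    ∃ b : ℝ, 0 < b ∧ ∀ k : ℕ, 1 ≤ k →
      ‖x k - xb‖ < b * (k : ℝ) ^ (-((1 - θ) / (2 * θ - 1))) := by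
  obtain ⟨N, hNK, hN⟩ := h.eventually_mem_ball
  have hθ1 : 0 < 1 - θ := by linarith [h.θ_lt_one]
  obtain ⟨B, hB, hBev⟩ := h.exists_norm_sub_le_rpow (s := 1 - θ) hθ1 (by linarith) le_rfl
  have ha := h.a_pos
  have hc := h.c_pos
  set p := 2 * θ - 1 with hp
  have hppos : 0 < p := by linarith
  set r := (1 - θ) / p with hr
  have hrpos : 0 < r := by positivity
  obtain ⟨μ, hμ, P, hP⟩ := exists_mul_rpow_le_one (Δ := Δ) (p := p) (A := c ^ 2 / a) (K := N)
    hppos (by positivity) h.gap_nonneg h.gap_antitone h.gap_tendsto (by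
      intro k hk hpos
      have := h.gap_rpow_le (hNK.trans hk) (hN k hk) hpos
      rwa [show 1 + p = 2 * θ by rw [hp]; ring])
  obtain ⟨b, hb, hlt⟩ := exists_pos_forall_lt_mul (r := fun k => ‖x (k + 1) - xb‖)
    (w := fun k => ((k + 1 : ℕ) : ℝ) ^ (-r)) (B := B * (2 / μ) ^ r) (fun k => by positivity) (by
      filter_upwards [hBev, eventually_ge_atTop (2 * P + 1)] with k hk hkP
      obtain ⟨j, rfl⟩ : ∃ j, k = P + j := ⟨k - P, by omega⟩
      have hj : 0 < (j : ℝ) := by exact_mod_cast (by omega : 0 < j)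
      -- `j = k - P` is at least half of `k + 1`
      have hjk : ((P + j + 1 : ℕ) : ℝ) ≤ 2 * j := by exact_mod_cast (by omega)
      refine hk.trans ?_
      rw [mul_assoc]
      gcongr
      have hkpos : (0 : ℝ) < ((P + j + 1 : ℕ) : ℝ) := by positivity
      have h1 : Δ (P + j) ^ p ≤ 2 / μ * ((P + j + 1 : ℕ) : ℝ)⁻¹ := by
        have h2 := hP j
        have h3 : Δ (P + j) ^ p ≤ 1 / (μ * j) := by
          rw [le_div_iff₀ (by positivity)]; linarith
        refine h3.trans ?_
        rw [← div_eq_mul_inv, div_div, div_le_div_iff₀ (by positivity) (by positivity)]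
        nlinarith
      calc Δ (P + j) ^ (1 - θ) = (Δ (P + j) ^ p) ^ r := by
            rw [← Real.rpow_mul (h.gap_nonneg _), hr, mul_div_cancel₀ _ hppos.ne']
        _ ≤ (2 / μ * ((P + j + 1 : ℕ) : ℝ)⁻¹) ^ r :=
            Real.rpow_le_rpow (Real.rpow_nonneg (h.gap_nonneg _) _) h1 hrpos.le
        _ = (2 / μ) ^ r * ((P + j + 1 : ℕ) : ℝ) ^ (-r) := by
            rw [Real.mul_rpow (by positivity) (by positivity), Real.inv_rpow hkpos.le,
              Real.rpow_neg hkpos.le])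
  refine ⟨b, hb, fun k hk => ?_⟩
  obtain ⟨m, rfl⟩ : ∃ m, k = m + 1 := ⟨k - 1, by omega⟩
  exact hlt m

end LojasiewiczDescent

/-! ### Extended-real-valued functions and their real parts -/

theorem Proper.coe_toReal {n : ℕ} {F : Rn n → EReal} (hF : Proper F) {x : Rn n}
    (hx : x ∈ effDom F) : ((F x).toReal : EReal) = F x :=
  EReal.coe_toReal (ne_of_lt hx) (hF.1 x)

theorem ConvexFun.convexOn_toReal {n : ℕ} {F : Rn n → EReal} (hF : ConvexFun F) (hp : Proper F)
    {C : Set (Rn n)} (hC : Convex ℝ C) (hCF : C ⊆ effDom F) :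
    ConvexOn ℝ C (fun x => (F x).toReal) := by
  refine convexOn_iff_forall_pos.2 ⟨hC, fun x hx y hy a b ha hb hab => ?_⟩
  have h1 := hF x y a b ha hb hab
  rw [← hp.coe_toReal (hCF hx), ← hp.coe_toReal (hCF hy),
    ← hp.coe_toReal (hCF (hC hx hy ha.le hb.le hab))] at h1
  exact_mod_cast h1

/-! ### Gradients, Hessians and strong convexity -/

theorem hasGradientAt_grad {n : ℕ} {F : Rn n → EReal} {C : Set (Rn n)} (hC : IsOpen C)
    (hF : ContDiffOn ℝ 1 (fun x => (F x).toReal) C) {x : Rn n} (hx : x ∈ C) :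
    HasGradientAt (fun z => (F z).toReal) (grad F x) x :=
  ((hF.differentiableOn one_ne_zero).differentiableAt (hC.mem_nhds hx)).hasGradientAt

theorem contDiffOn_grad {n : ℕ} {F : Rn n → EReal} {C : Set (Rn n)} (hC : IsOpen C) {m k : ℕ∞}
    (hF : ContDiffOn ℝ k (fun x => (F x).toReal) C) (hmk : m + 1 ≤ k) :
    ContDiffOn ℝ m (grad F) C := by
  have h1 : ContDiffOn ℝ m (fderiv ℝ fun x => (F x).toReal) C :=
    hF.fderiv_of_isOpen hC (by exact_mod_cast hmk)
  exact (InnerProductSpace.toDual ℝ (Rn n)).symm.contDiff.comp_contDiffOn h1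

theorem continuousOn_grad {n : ℕ} {F : Rn n → EReal} {C : Set (Rn n)} (hC : IsOpen C)
    (hF : ContDiffOn ℝ 1 (fun x => (F x).toReal) C) : ContinuousOn (grad F) C :=
  (contDiffOn_grad (m := 0) (k := 1) hC hF (by simp)).continuousOn

theorem hasFDerivAt_hess {n : ℕ} {F : Rn n → EReal} {C : Set (Rn n)} (hC : IsOpen C)
    (hF : ContDiffOn ℝ 2 (fun x => (F x).toReal) C) {x : Rn n} (hx : x ∈ C) :
    HasFDerivAt (grad F) (hess F x) x :=
  (((contDiffOn_grad (m := 1) (k := 2) hC hF (by norm_num)).differentiableOn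
    one_ne_zero).differentiableAt (hC.mem_nhds hx)).hasFDerivAt

theorem continuousOn_hess {n : ℕ} {F : Rn n → EReal} {C : Set (Rn n)} (hC : IsOpen C)
    (hF : ContDiffOn ℝ 2 (fun x => (F x).toReal) C) : ContinuousOn (hess F) C :=
  (contDiffOn_grad (m := 1) (k := 2) hC hF (by norm_num)).continuousOn_fderiv_of_isOpen hC le_rfl

theorem strongConvexOn_add_inner_add_le {E : Type*} [NormedAddCommGroup E]
    [InnerProductSpace ℝ E] [CompleteSpace E] {C : Set E} {σ : ℝ} {P : E → ℝ}
    (hP : StrongConvexOn C σ P) {x y p : E} (hx : x ∈ C) (hy : y ∈ C) (hp : HasGradientAt P p x) :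
    P x + inner ℝ p (y - x) + σ / 2 * ‖y - x‖ ^ 2 ≤ P y := by
  have hline : HasDerivAt (fun s : ℝ => P (x + s • (y - x))) (inner ℝ p (y - x)) 0 := by
    have h1 : HasDerivAt (fun s : ℝ => x + s • (y - x)) (y - x) 0 := by
      simpa using ((hasDerivAt_id (0 : ℝ)).smul_const (y - x)).const_add x
    have h2 : HasFDerivAt P (InnerProductSpace.toDual ℝ E p) (x + (0 : ℝ) • (y - x)) := by
      simpa using hp.hasFDerivAt
    have h3 := h2.comp_hasDerivAt (0 : ℝ) h1
    rw [InnerProductSpace.toDual_apply_apply] at h3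
    exact h3
  have hslope := hline.tendsto_slope_zero_right
  have hrhs : Tendsto (fun s : ℝ => P y - P x - (1 - s) * (σ / 2 * ‖y - x‖ ^ 2)) (𝓝[>] 0)
      (𝓝 (P y - P x - (1 - 0) * (σ / 2 * ‖y - x‖ ^ 2))) :=
    Tendsto.mono_left (Continuous.tendsto (by fun_prop) 0) nhdsWithin_le_nhds
  have hle := le_of_tendsto_of_tendsto hslope hrhs (by
    filter_upwards [Ioo_mem_nhdsGT (zero_lt_one : (0 : ℝ) < 1)] with s hs
    have h1 := hP.2 hx hy (by linarith [hs.2] : 0 ≤ 1 - s) hs.1.le (by ring)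
    have h2 : (1 - s) • x + s • y = x + s • (y - x) := by module
    rw [h2, norm_sub_rev] at h1
    simp only [smul_eq_mul] at h1
    simp only [zero_add, zero_smul, add_zero, smul_eq_mul]
    rw [inv_mul_le_iff₀ hs.1]
    linarith)
  linarith

/-- The derivative of the gradient of a `σ`-strongly convex function is bounded below by `σ`; no
second derivative of the function along lines is needed, only monotonicity of the gradient. -/
theorem strongConvexOn_le_inner_fderiv_grad {E : Type*} [NormedAddCommGroup E]
    [InnerProductSpace ℝ E] [CompleteSpace E] {C : Set E} {σ : ℝ} {P : E → ℝ} {p : E → E}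
    (hC : IsOpen C) (hP : StrongConvexOn C σ P) (hp : ∀ x ∈ C, HasGradientAt P (p x) x)
    {x : E} (hx : x ∈ C) {H : E →L[ℝ] E} (hH : HasFDerivAt p H x) (w : E) :
    σ * ‖w‖ ^ 2 ≤ inner ℝ (H w) w := by
  have hcurve : HasDerivAt (fun s : ℝ => x + s • w) w 0 := by
    simpa using ((hasDerivAt_id (0 : ℝ)).smul_const w).const_add x
  have hline : HasDerivAt (fun s : ℝ => inner ℝ (p (x + s • w)) w) (inner ℝ (H w) w) 0 := by
    have h2 : HasFDerivAt p H (x + (0 : ℝ) • w) := by simpa using hH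
    have h3 : HasDerivAt (fun s : ℝ => p (x + s • w)) (H w) 0 := h2.comp_hasDerivAt (0 : ℝ) hcurve
    simpa using h3.inner ℝ (hasDerivAt_const (0 : ℝ) w)
  refine ge_of_tendsto hline.tendsto_slope_zero_right ?_
  have hmem : ∀ᶠ s in 𝓝[>] (0 : ℝ), x + s • w ∈ C :=
    (hcurve.continuousAt.eventually_mem (by simpa using hC.mem_nhds hx)).filter_mono
      nhdsWithin_le_nhds
  filter_upwards [hmem, self_mem_nhdsWithin] with s hs hs0
  have hs0 : 0 < s := hs0
  simp only [zero_add, zero_smul, add_zero, smul_eq_mul]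
  rw [le_inv_mul_iff₀ hs0]
  have h1 := strongConvexOn_add_inner_add_le hP hx hs (hp x hx)
  have h2 := strongConvexOn_add_inner_add_le hP hs hx (hp _ hs)
  have e1 : x + s • w - x = s • w := by abel
  have e2 : x - (x + s • w) = -(s • w) := by abel
  rw [e1, inner_smul_right, norm_smul, Real.norm_of_nonneg hs0.le] at h1
  rw [e2, inner_neg_right, inner_smul_right, norm_neg, norm_smul,
    Real.norm_of_nonneg hs0.le] at h2
  have h3 : s * (s * (σ * ‖w‖ ^ 2)) ≤ s * (inner ℝ (p (x + s • w)) w - inner ℝ (p x) w) := by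
    nlinarith
  exact le_of_mul_le_mul_left h3 hs0

/-! ### Subdifferentials -/

theorem regularSubdiff_subset_subdiff {n : ℕ} (F : Rn n → EReal) (x : Rn n) :
    regularSubdiff F x ⊆ subdiff F x := fun ξ hξ =>
  ⟨hξ.1, fun _ => x, fun _ => ξ, tendsto_const_nhds, tendsto_const_nhds, tendsto_const_nhds,
    fun _ => hξ⟩

/-- Local sum rule: near `y` the function is the sum of `A`, differentiable at `y` with gradient
`a`, and of `B`, for which `b` satisfies the subgradient inequality near `y`. -/
theorem add_mem_regularSubdiff {n : ℕ} {F : Rn n → EReal} {A B : Rn n → ℝ} {C : Set (Rn n)}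
    {y a b : Rn n} (hC : C ∈ 𝓝 y) (hF : ∀ z ∈ C, F z = ((A z + B z : ℝ) : EReal))
    (hA : HasGradientAt A a y) (hB : ∀ z ∈ C, B y + inner ℝ b (z - y) ≤ B z) :
    a + b ∈ regularSubdiff F y := by
  have hFy := hF y (mem_of_mem_nhds hC)
  refine ⟨?_, ?_⟩
  · change F y < ⊤
    rw [hFy]; exact EReal.coe_lt_top _
  refine le_of_forall_lt fun r hr => ?_
  obtain ⟨s, hrs, hs⟩ := EReal.lt_iff_exists_real_btwn.1 hr
  obtain ⟨s', hss', hs'⟩ := EReal.lt_iff_exists_real_btwn.1 hs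
  have hs0 : s' < 0 := by exact_mod_cast hs'
  refine hrs.trans_le (hss'.le.trans ?_)
  refine le_liminf_of_le (by isBoundedDefault) ?_
  have hlittle := (hasGradientAt_iff_isLittleO.1 hA).bound (neg_pos.2 hs0)
  filter_upwards [nhdsWithin_le_nhds hlittle, nhdsWithin_le_nhds hC, self_mem_nhdsWithin]
    with z hz hzC hzy
  have hpos : 0 < ‖y - z‖ := norm_pos_iff.2 (sub_ne_zero.2 (Ne.symm hzy))
  rw [hF z hzC, hFy, ← EReal.coe_sub, ← EReal.coe_sub, ← EReal.coe_div, EReal.coe_le_coe_iff,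
    le_div_iff₀ hpos, inner_add_left, norm_sub_rev]
  have h1 := (abs_le.1 (by simpa using hz : |A z - A y - inner ℝ a (z - y)| ≤ -s' * ‖z - y‖)).1
  linarith [hB z hzC]

/-- For convex `g` the difference quotients along the segment from `x` to `u` are bounded above by
the one at `u`, so the local condition on `ξ` is a global one. -/
theorem inner_le_of_mem_regularSubdiff {n : ℕ} {g : Rn n → EReal} (hp : Proper g)
    (hg : ConvexFun g) {x ξ u : Rn n} (hξ : ξ ∈ regularSubdiff g x) (hu : u ∈ effDom g) :
    (g x).toReal + inner ℝ ξ (u - x) ≤ (g u).toReal := by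
  obtain ⟨hx, hlim⟩ := hξ
  by_contra! hlt
  have hne : u ≠ x := by rintro rfl; simp at hlt
  have hw : 0 < ‖u - x‖ := norm_pos_iff.2 (sub_ne_zero.2 hne)
  set δ := ((g u).toReal - (g x).toReal - inner ℝ ξ (u - x)) / ‖u - x‖ with hδ
  have hδ0 : δ < 0 := div_neg_of_neg_of_pos (by linarith) hw
  have htend : Tendsto (fun s : ℝ => x + s • (u - x)) (𝓝[>] 0) (𝓝[≠] x) := by
    refine tendsto_nhdsWithin_iff.2 ⟨?_, ?_⟩
    · have : Tendsto (fun s : ℝ => x + s • (u - x)) (𝓝 0) (𝓝 (x + (0 : ℝ) • (u - x))) :=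
        Continuous.tendsto (by fun_prop) 0
      rw [zero_smul, add_zero] at this
      exact this.mono_left nhdsWithin_le_nhds
    · filter_upwards [self_mem_nhdsWithin] with s hs
      have hs : 0 < s := hs
      simp [hs.ne', sub_ne_zero.2 hne]
  have hfreq : ∃ᶠ z in 𝓝[≠] x,
      (g z - g x - ((inner ℝ ξ (z - x) : ℝ) : EReal)) / ((‖x - z‖ : ℝ) : EReal) ≤ (δ : EReal) := by
    refine htend.frequently (Eventually.frequently ?_)
    filter_upwards [Ioo_mem_nhdsGT (zero_lt_one : (0 : ℝ) < 1)] with s hs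
    have hconv := hg x u (1 - s) s (by linarith [hs.2]) hs.1 (by ring)
    rw [show (1 - s) • x + s • u = x + s • (u - x) by module, ← hp.coe_toReal hx,
      ← hp.coe_toReal hu, ← EReal.coe_mul, ← EReal.coe_mul, ← EReal.coe_add] at hconv
    have hz : x + s • (u - x) ∈ effDom g := hconv.trans_lt (EReal.coe_lt_top _)
    rw [← hp.coe_toReal hz, EReal.coe_le_coe_iff] at hconv
    rw [← hp.coe_toReal hx, ← hp.coe_toReal hz, ← EReal.coe_sub, ← EReal.coe_sub,
      ← EReal.coe_div, EReal.coe_le_coe_iff]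
    have e1 : x + s • (u - x) - x = s • (u - x) := by abel
    have e2 : x - (x + s • (u - x)) = -(s • (u - x)) := by abel
    rw [e1, e2, norm_neg, norm_smul, Real.norm_of_nonneg hs.1.le, inner_smul_right,
      div_le_iff₀ (mul_pos hs.1 hw), hδ, mul_comm s ‖u - x‖, ← mul_assoc, div_mul_cancel₀ _ hw.ne']
    linarith
  have h1 := hlim.trans (liminf_le_of_frequently_le hfreq)
  have h2 : (0 : ℝ) ≤ δ := by exact_mod_cast h1
  linarith

/-- Limiting subgradients of a convex function satisfy the subgradient inequality. -/
theorem inner_le_of_mem_subdiff {n : ℕ} {g : Rn n → EReal} (hp : Proper g)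
    (hg : ConvexFun g) {x ξ u : Rn n} (hξ : ξ ∈ subdiff g x) (hu : u ∈ effDom g) :
    (g x).toReal + inner ℝ ξ (u - x) ≤ (g u).toReal := by
  obtain ⟨hx, xs, ξs, hxs, hgs, hξs, hreg⟩ := hξ
  have h1 : Tendsto (fun k => (g (xs k)).toReal) atTop (𝓝 (g x).toReal) :=
    (EReal.tendsto_toReal (ne_of_lt hx) (hp.1 x)).comp hgs
  have h2 : Tendsto (fun k => inner ℝ (ξs k) (u - xs k)) atTop (𝓝 (inner ℝ ξ (u - x))) :=
    hξs.inner (tendsto_const_nhds.sub hxs)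
  exact le_of_tendsto (h1.add h2)
    (.of_forall fun k => inner_le_of_mem_regularSubdiff hp hg (hreg k) hu)

/-! ### The proximal subproblem -/

theorem ProblemAssumptions.subset_dom_f {n : ℕ} {C : Set (Rn n)} {φ f g : Rn n → EReal}
    (h : ProblemAssumptions C φ f g) : C ⊆ effDom f := by
  have h1 : C ⊆ effDom φ := by
    conv_lhs => rw [← h.kernel.interior_dom]
    exact interior_subset
  exact h1.trans h.dom_f

/-- The real values of the objective `f + g`. -/
noncomputable def realObjective {n : ℕ} (f g : Rn n → EReal) (z : Rn n) : ℝ := (f z).toReal + (g z).toReal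

theorem ProblemAssumptions.objective_eq {n : ℕ} {C : Set (Rn n)} {φ f g : Rn n → EReal}
    (h : ProblemAssumptions C φ f g) {z : Rn n} (hz : z ∈ C) :
    objective f g z = (realObjective f g z : EReal) := by
  rw [objective, ← h.f_proper.coe_toReal (h.subset_dom_f hz), ← h.g_proper.coe_toReal (h.dom_g hz),
    ← EReal.coe_add]
  rfl

/-- The subgradient of `g` at `y` given by the optimality condition of the subproblem at `x`. The
gradient of the quadratic form of `∇²φ(x)` is written with the adjoint, so that symmetry of the
Hessian plays no role. -/
noncomputable def proxSubgrad {n : ℕ} (φ f : Rn n → EReal) (lam : ℝ) (x y : Rn n) : Rn n :=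
  -grad f x - (1 / (2 * lam)) •
    (hess φ x (y - x) + ContinuousLinearMap.adjoint (hess φ x) (y - x))

theorem nonneg_of_forall_mul_add_sq_mul_nonneg {α β : ℝ}
    (h : ∀ s ∈ Set.Ioo (0 : ℝ) 1, 0 ≤ s * α + s ^ 2 * β) : 0 ≤ α := by
  have hlim : Tendsto (fun s : ℝ => α + s * β) (𝓝[>] 0) (𝓝 (α + 0 * β)) :=
    Tendsto.mono_left (Continuous.tendsto (by fun_prop) 0) nhdsWithin_le_nhds
  rw [zero_mul, add_zero] at hlim
  refine ge_of_tendsto hlim ?_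
  filter_upwards [Ioo_mem_nhdsGT (zero_lt_one : (0 : ℝ) < 1)] with s hs
  have h1 := h s hs
  have h2 : s * 0 ≤ s * (α + s * β) := by linarith
  exact le_of_mul_le_mul_left h2 hs.1

theorem ProblemAssumptions.add_inner_proxSubgrad_le {n : ℕ} {C : Set (Rn n)}
    {φ f g : Rn n → EReal} (h : ProblemAssumptions C φ f g) (hC : Convex ℝ C) {lam : ℝ}
    {x y u : Rn n} (hy : y ∈ approxProx C φ f g lam x) (hyC : y ∈ C) (hu : u ∈ C) :
    (g y).toReal + inner ℝ (proxSubgrad φ f lam x y) (u - y) ≤ (g u).toReal := by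
  have hconv := h.g_convex.convexOn_toReal h.g_proper hC h.dom_g
  set H := hess φ x
  set d := y - x
  set w := u - y
  -- compare `y` with the points `y + s w` of the segment and divide by `s`
  have key : 0 ≤ inner ℝ (grad f x) w + (g u).toReal - (g y).toReal
      + 1 / (2 * lam) * (inner ℝ (H d) w + inner ℝ (H w) d) := by
    refine nonneg_of_forall_mul_add_sq_mul_nonneg
      (β := 1 / (2 * lam) * inner ℝ (H w) w) fun s hs => ?_
    have hcomb : (1 - s) • y + s • u = y + s • w := by simp only [w]; module
    have hmem : y + s • w ∈ C := hcomb ▸ hC hyC hu (by linarith [hs.2]) hs.1.le (by ring)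
    have h1 := hconv.2 hyC hu (by linarith [hs.2] : 0 ≤ 1 - s) hs.1.le (by ring)
    rw [hcomb] at h1
    simp only [smul_eq_mul] at h1
    have h2 := hy.2 _ (subset_closure hmem)
    simp only [subproblem, approxBregman] at h2
    rw [← h.g_proper.coe_toReal (h.dom_g hyC), ← h.g_proper.coe_toReal (h.dom_g hmem)] at h2
    have h3 : inner ℝ (grad f x) (y - x) + (g y).toReal
        + 1 / lam * (1 / 2 * inner ℝ (H (y - x)) (y - x))
        ≤ inner ℝ (grad f x) (y + s • w - x) + (g (y + s • w)).toReal
        + 1 / lam * (1 / 2 * inner ℝ (H (y + s • w - x)) (y + s • w - x)) := by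
      exact_mod_cast h2
    rw [show y + s • w - x = d + s • w by simp only [d]; abel] at h3
    simp only [map_add, map_smul, inner_add_left, inner_add_right, inner_smul_left,
      inner_smul_right, RCLike.conj_to_real] at h3
    have e : (1 : ℝ) / (2 * lam) = 1 / lam * (1 / 2) := by
      rw [one_div_mul_one_div, mul_comm]
    rw [e]
    change inner ℝ (grad f x) d + _ + _ * (_ * inner ℝ (H d) d) ≤ _ at h3
    linarith
  have e : inner ℝ (proxSubgrad φ f lam x y) w = -inner ℝ (grad f x) w
      - 1 / (2 * lam) * (inner ℝ (H d) w + inner ℝ (H w) d) := by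
    rw [proxSubgrad, inner_sub_left, inner_neg_left, inner_smul_left, inner_add_left,
      ContinuousLinearMap.adjoint_inner_left, real_inner_comm d (H w)]
    rfl
  rw [e]
  linarith

/-! ### Descent, step lengths and stationarity -/

/-- A run of the algorithm together with the standing assumptions on the problem. -/
structure Run {n : ℕ} (C : Set (Rn n)) (φ f g : Rn n → EReal) (σ lam c₁ c₂ tbar : ℝ)
    (x y ξ : ℕ → Rn n) (t : ℕ → ℝ) : Prop where
  isOpen : IsOpen C
  convex : Convex ℝ C
  prob : ProblemAssumptions C φ f g
  feas : Feasibility C φ f g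
  σ_pos : 0 < σ
  strong : StrongConvexOn C σ (fun x => (φ x).toReal)
  lip : LocallyLipschitzGrad C f
  lam_pos : 0 < lam
  c₁_pos : 0 < c₁
  c₂_lt_one : c₂ < 1
  gen : GeneratedByABPG C φ f g lam c₁ c₂ x y ξ t
  step_lt : ∀ k, t k < tbar

namespace Run

variable {n : ℕ} {C : Set (Rn n)} {φ f g : Rn n → EReal} {σ lam c₁ c₂ tbar : ℝ}
  {x y ξ : ℕ → Rn n} {t : ℕ → ℝ}

theorem prox_mem (h : Run C φ f g σ lam c₁ c₂ tbar x y ξ t) (k : ℕ) : y k ∈ C :=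
  h.feas _ (h.gen.mem k) lam h.lam_pos (h.gen.sub_mem k)

theorem le_inner_hess (h : Run C φ f g σ lam c₁ c₂ tbar x y ξ t) {z : Rn n} (hz : z ∈ C)
    (w : Rn n) : σ * ‖w‖ ^ 2 ≤ inner ℝ (hess φ z w) w :=
  strongConvexOn_le_inner_fderiv_grad h.isOpen h.strong
    (fun _ hu => hasGradientAt_grad h.isOpen (h.prob.kernel_C2.of_le (by norm_num)) hu) hz
    (hasFDerivAt_hess h.isOpen h.prob.kernel_C2 hz) w

/-- The subgradient inequality for `proxSubgrad` tested at `x k`: the linearized change of the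
objective along the search direction is at most `-⟨∇²φ(x) d, d⟩ / lam`. -/
theorem inner_add_sub_le (h : Run C φ f g σ lam c₁ c₂ tbar x y ξ t) (k : ℕ) :
    inner ℝ (grad f (x k)) (y k - x k) + (g (y k)).toReal - (g (x k)).toReal
      ≤ -(1 / lam * inner ℝ (hess φ (x k) (y k - x k)) (y k - x k)) := by
  have h1 := h.prob.add_inner_proxSubgrad_le h.convex (h.gen.sub_mem k) (h.prox_mem k)
    (h.gen.mem k)
  rw [← neg_sub (y k) (x k), inner_neg_right, proxSubgrad, inner_sub_left, inner_neg_left,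
    inner_smul_left, inner_add_left, ContinuousLinearMap.adjoint_inner_left,
    real_inner_comm (hess φ (x k) (y k - x k)) (y k - x k), RCLike.conj_to_real] at h1
  have e : (1 : ℝ) / (2 * lam) = 1 / lam * (1 / 2) := by
    rw [one_div_mul_one_div, mul_comm]
  rw [e] at h1
  linarith

theorem objective_succ_le (h : Run C φ f g σ lam c₁ c₂ tbar x y ξ t) (k : ℕ) :
    objective f g (x (k + 1)) ≤ objective f g (y k) ∧
      objective f g (x (k + 1)) ≤ objective f g (x k + t k • (y k - x k)) := by
  by_cases hlt : objective f g (y k) < objective f g (x k + t k • (y k - x k))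
  · rw [h.gen.update_sub k hlt]; exact ⟨le_rfl, hlt.le⟩
  · rw [h.gen.update_line k hlt]; exact ⟨not_lt.1 hlt, le_rfl⟩

theorem step_eq (h : Run C φ f g σ lam c₁ c₂ tbar x y ξ t) (k : ℕ) :
    x (k + 1) - x k = y k - x k ∨ x (k + 1) - x k = t k • (y k - x k) := by
  by_cases hlt : objective f g (y k) < objective f g (x k + t k • (y k - x k))
  · left; rw [h.gen.update_sub k hlt]
  · right; rw [h.gen.update_line k hlt]; abel

theorem norm_step_le (h : Run C φ f g σ lam c₁ c₂ tbar x y ξ t) (k : ℕ) :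
    ‖x (k + 1) - x k‖ ≤ max 1 tbar * ‖y k - x k‖ := by
  rcases h.step_eq k with he | he
  · rw [he]
    exact le_mul_of_one_le_left (norm_nonneg _) (le_max_left _ _)
  · rw [he, norm_smul, Real.norm_of_nonneg (h.gen.step_pos k).le]
    gcongr
    exact (h.step_lt k).le.trans (le_max_right _ _)

/-- Sufficient decrease from the Armijo condition. -/
theorem descent (h : Run C φ f g σ lam c₁ c₂ tbar x y ξ t) (k : ℕ) :
    c₁ * σ / (2 * lam) * (t k * ‖y k - x k‖ ^ 2)
      ≤ realObjective f g (x k) - realObjective f g (x (k + 1)) := by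
  -- in a stopped run the step size is arbitrary, and both update rules give `x (k + 1) = x k`
  by_cases hd : y k - x k = 0
  · have : x (k + 1) = x k := by
      rcases h.step_eq k with he | he <;> rw [hd] at he
      · exact sub_eq_zero.1 he
      · exact sub_eq_zero.1 (by simpa using he)
    rw [this, hd]; simp
  have hx := h.gen.mem k
  have hA := h.gen.armijo_neg k hd
  have hxd : x k + (y k - x k) = y k := by abel
  rw [armijo, hxd, h.prob.objective_eq hx, ← h.prob.g_proper.coe_toReal (h.prob.dom_g hx),
    ← h.prob.g_proper.coe_toReal (h.prob.dom_g (h.prox_mem k)), ← EReal.coe_add, ← EReal.coe_sub,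
    ← EReal.coe_add, ← EReal.coe_mul] at hA
  set Θ := inner ℝ (grad f (x k)) (y k - x k) + (g (y k)).toReal - (g (x k)).toReal
    + 1 / (2 * lam) * inner ℝ (hess φ (x k) (y k - x k)) (y k - x k) with hΘ
  have h1 : (realObjective f g (x (k + 1)) : EReal) ≤ objective f g (x k + t k • (y k - x k))
      + indicatorFun (closure C) (x k + t k • (y k - x k)) := by
    rw [← h.prob.objective_eq (h.gen.mem (k + 1))]
    refine (h.objective_succ_le k).2.trans (le_add_of_nonneg_right ?_)
    unfold indicatorFun
    split_ifs <;> simp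
  have h2 : (realObjective f g (x (k + 1)) : EReal) - (realObjective f g (x k) : EReal)
      - ((c₁ * t k * Θ : ℝ) : EReal) < 0 :=
    (EReal.sub_le_sub (EReal.sub_le_sub h1 le_rfl) le_rfl).trans_lt hA
  have h3 : realObjective f g (x (k + 1)) - realObjective f g (x k) - c₁ * t k * Θ < 0 := by
    exact_mod_cast h2
  have h4 : Θ ≤ -(σ / (2 * lam) * ‖y k - x k‖ ^ 2) := by
    have h5 := h.inner_add_sub_le k
    have h6 := mul_le_mul_of_nonneg_left (h.le_inner_hess hx (y k - x k))
      (by have := h.lam_pos; positivity : 0 ≤ 1 / (2 * lam))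
    have e : (1 : ℝ) / lam = 2 * (1 / (2 * lam)) := by field_simp
    have e' : σ / (2 * lam) = 1 / (2 * lam) * σ := by ring
    rw [e] at h5
    rw [e', hΘ]
    linarith
  have h5 := mul_le_mul_of_nonneg_left h4 (mul_pos h.c₁_pos (h.gen.step_pos k)).le
  have e : c₁ * σ / (2 * lam) * (t k * ‖y k - x k‖ ^ 2)
      = c₁ * t k * (σ / (2 * lam) * ‖y k - x k‖ ^ 2) := by ring
  rw [e]
  linarith

theorem antitone_realObjective (h : Run C φ f g σ lam c₁ c₂ tbar x y ξ t) :
    Antitone fun k => realObjective f g (x k) := by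
  refine antitone_nat_of_succ_le fun k => ?_
  have h1 := h.descent k
  have h2 := h.lam_pos
  have h3 := h.c₁_pos
  have h4 := h.σ_pos
  have h5 := h.gen.step_pos k
  have : 0 ≤ c₁ * σ / (2 * lam) * (t k * ‖y k - x k‖ ^ 2) := by positivity
  linarith

/-- The Wolfe condition forces the gradient of `f` to change along the step. -/
theorem mul_norm_le_norm_grad_sub (h : Run C φ f g σ lam c₁ c₂ tbar x y ξ t) {k : ℕ}
    (hd : y k - x k ≠ 0) :
    (1 - c₂) * (σ / lam) * ‖y k - x k‖
      ≤ ‖grad f (x k + t k • (y k - x k)) - grad f (x k)‖ := by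
  have hW := h.gen.wolfe_pos k hd
  rw [wolfe, inner_add_left, inner_add_left] at hW
  have h1 := inner_le_of_mem_subdiff h.prob.g_proper h.prob.g_convex (h.gen.subgrad k)
    (h.prob.dom_g (h.prox_mem k))
  have h2 := h.inner_add_sub_le k
  have h3 := mul_le_mul_of_nonneg_left (h.le_inner_hess (h.gen.mem k) (y k - x k))
    (by have := h.lam_pos; positivity : 0 ≤ 1 / lam)
  have h4 : inner ℝ (grad f (x k)) (y k - x k) + inner ℝ (ξ k) (y k - x k)
      ≤ -(σ / lam * ‖y k - x k‖ ^ 2) := by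
    have e : σ / lam = 1 / lam * σ := by ring
    rw [e]; linarith
  have h5 := mul_le_mul_of_nonneg_left h4 (sub_pos.2 h.c₂_lt_one).le
  have h6 : inner ℝ (grad f (x k + t k • (y k - x k)) - grad f (x k)) (y k - x k)
      ≤ ‖grad f (x k + t k • (y k - x k)) - grad f (x k)‖ * ‖y k - x k‖ := real_inner_le_norm _ _
  rw [inner_sub_left] at h6
  refine le_of_mul_le_mul_right ?_ (norm_pos_iff.2 hd)
  linarith

theorem continuousOn_toReal_g (h : Run C φ f g σ lam c₁ c₂ tbar x y ξ t) :
    ContinuousOn (fun z => (g z).toReal) C :=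
  (h.prob.g_convex.convexOn_toReal h.prob.g_proper h.convex h.prob.dom_g).continuousOn h.isOpen

theorem continuousOn_realObjective (h : Run C φ f g σ lam c₁ c₂ tbar x y ξ t) :
    ContinuousOn (realObjective f g) C :=
  h.prob.f_C1.continuousOn.add h.continuousOn_toReal_g

theorem tendsto_realObjective (h : Run C φ f g σ lam c₁ c₂ tbar x y ξ t) {xbar : Rn n}
    (hxbar : xbar ∈ C) (hclus : MapClusterPt xbar atTop x) :
    Tendsto (fun k => realObjective f g (x k)) atTop (𝓝 (realObjective f g xbar)) := by
  obtain ⟨m, hm, hlim⟩ := hclus.tendsto_subseq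
  refine (tendsto_iff_tendsto_subseq_of_antitone h.antitone_realObjective hm.tendsto_atTop).2 ?_
  exact ((h.continuousOn_realObjective.continuousAt (h.isOpen.mem_nhds hxbar)).tendsto).comp hlim

theorem tendsto_decrease (h : Run C φ f g σ lam c₁ c₂ tbar x y ξ t) {xbar : Rn n}
    (hxbar : xbar ∈ C) (hclus : MapClusterPt xbar atTop x) :
    Tendsto (fun k => realObjective f g (x k) - realObjective f g (x (k + 1))) atTop (𝓝 0) := by
  have hψ := h.tendsto_realObjective hxbar hclus
  simpa using hψ.sub ((tendsto_add_atTop_iff_nat 1).2 hψ)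

/-- Near an accumulation point in `C` the step sizes are bounded below, so that the decrease of
the objective is quadratic in the length of the search direction. A step leaving the ball on which
`∇f` is Lipschitz would be long, and hence would decrease the objective by a fixed amount. -/
theorem exists_quadratic_decrease (h : Run C φ f g σ lam c₁ c₂ tbar x y ξ t) {xbar : Rn n}
    (hxbar : xbar ∈ C) (hclus : MapClusterPt xbar atTop x) :
    ∃ r a : ℝ, 0 < r ∧ 0 < a ∧ ∃ K : ℕ, ∀ k ≥ K, x k ∈ Metric.ball xbar r →
      a * ‖y k - x k‖ ^ 2 ≤ realObjective f g (x k) - realObjective f g (x (k + 1)) := by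
  obtain ⟨r, hr, hrC⟩ := Metric.nhds_basis_closedBall.mem_iff.1 (h.isOpen.mem_nhds hxbar)
  obtain ⟨L, hL⟩ := h.lip _ (isCompact_closedBall xbar r) hrC
  have hσ := h.σ_pos
  have hlam := h.lam_pos
  have hc₁ := h.c₁_pos
  have hc₂ : 0 < 1 - c₂ := sub_pos.2 h.c₂_lt_one
  have htbar : 0 < tbar := (h.gen.step_pos 0).trans (h.step_lt 0)
  set α := c₁ * σ / (2 * lam) with hα
  set κ := (1 - c₂) * (σ / lam) with hκ
  have hαpos : 0 < α := by positivity
  have hκpos : 0 < κ := by positivity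
  have hdiff := h.tendsto_decrease hxbar hclus
  obtain ⟨K, hK⟩ := eventually_atTop.1
    (hdiff.eventually_lt_const (by positivity : 0 < α * ((r / 2) ^ 2 / tbar)))
  refine ⟨r / 2, α * (κ / (L + 1)), by positivity, by positivity, K, fun k hk hxk => ?_⟩
  have hdesc := h.descent k
  have htk := h.gen.step_pos k
  by_cases hd : y k - x k = 0
  · rw [hd, norm_zero] at hdesc ⊢
    simpa using hdesc
  set δ := ‖y k - x k‖ with hδ
  have hδpos : 0 < δ := norm_pos_iff.2 hd
  have hshort : t k * δ < r / 2 := by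
    by_contra! hlong
    have h1 : (r / 2) ^ 2 / tbar ≤ t k * δ ^ 2 := by
      rw [div_le_iff₀ htbar]
      calc (r / 2) ^ 2 ≤ (t k * δ) ^ 2 := by gcongr
        _ = t k * δ ^ 2 * t k := by ring
        _ ≤ t k * δ ^ 2 * tbar := by gcongr; exact (h.step_lt k).le
    linarith [hK k hk, mul_le_mul_of_nonneg_left h1 hαpos.le]
  rw [Metric.mem_ball, dist_eq_norm] at hxk
  have hstep : ‖t k • (y k - x k)‖ = t k * δ := by
    rw [norm_smul, Real.norm_of_nonneg htk.le]
  have hmem : x k ∈ Metric.closedBall xbar r := by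
    rw [Metric.mem_closedBall, dist_eq_norm]; linarith
  have hmem' : x k + t k • (y k - x k) ∈ Metric.closedBall xbar r := by
    rw [Metric.mem_closedBall, dist_eq_norm, add_sub_right_comm]
    refine (norm_add_le _ _).trans ?_
    rw [hstep]; linarith
  have h1 := hL.norm_sub_le hmem' hmem
  rw [add_sub_cancel_left, hstep] at h1
  have h2 : κ * δ ≤ (L + 1) * t k * δ := by
    have h3 := h.mul_norm_le_norm_grad_sub hd
    have h4 : 0 < t k * δ := by positivity
    linarith
  have h3 : κ / (L + 1) ≤ t k := by
    rw [div_le_iff₀ (by positivity)]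
    linarith [le_of_mul_le_mul_right h2 hδpos]
  calc α * (κ / (L + 1)) * δ ^ 2 = α * (κ / (L + 1) * δ ^ 2) := by ring
    _ ≤ α * (t k * δ ^ 2) := by gcongr
    _ ≤ _ := hdesc

/-- At an accumulation point in `C`, `-∇f` satisfies the subgradient inequality of `g` on `C`: the
optimality conditions of the subproblems pass to the limit along a subsequence. -/
theorem sub_inner_grad_le (h : Run C φ f g σ lam c₁ c₂ tbar x y ξ t) {xbar : Rn n}
    (hxbar : xbar ∈ C) (hclus : MapClusterPt xbar atTop x) {u : Rn n} (hu : u ∈ C) :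
    (g xbar).toReal + inner ℝ (-grad f xbar) (u - xbar) ≤ (g u).toReal := by
  obtain ⟨r, a, hr, ha, K, hdec⟩ := h.exists_quadratic_decrease hxbar hclus
  obtain ⟨m, hm, hlim⟩ := hclus.tendsto_subseq
  have hnhds := h.isOpen.mem_nhds hxbar
  have hdiff := h.tendsto_decrease hxbar hclus
  have hd : Tendsto (fun j => y (m j) - x (m j)) atTop (𝓝 0) := by
    have hsq : Tendsto (fun j => √((realObjective f g (x (m j))
        - realObjective f g (x (m j + 1))) / a)) atTop (𝓝 0) := by
      simpa using ((hdiff.comp hm.tendsto_atTop).div_const a).sqrt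
    refine squeeze_zero_norm' ?_ hsq
    filter_upwards [hlim.eventually (Metric.ball_mem_nhds xbar hr),
      hm.tendsto_atTop.eventually_ge_atTop K] with j hj hjK
    apply Real.le_sqrt_of_sq_le
    rw [le_div_iff₀ ha]
    linarith [hdec (m j) hjK hj]
  have hy : Tendsto (fun j => y (m j)) atTop (𝓝 xbar) := by
    simpa using hd.add hlim
  have hgy : Tendsto (fun j => (g (y (m j))).toReal) atTop (𝓝 (g xbar).toReal) :=
    (h.continuousOn_toReal_g.continuousAt hnhds).tendsto.comp hy
  have hgrad : Tendsto (fun j => grad f (x (m j))) atTop (𝓝 (grad f xbar)) :=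
    ((continuousOn_grad h.isOpen h.prob.f_C1).continuousAt hnhds).tendsto.comp hlim
  have hhess : Tendsto (fun j => hess φ (x (m j))) atTop (𝓝 (hess φ xbar)) :=
    ((continuousOn_hess h.isOpen h.prob.kernel_C2).continuousAt hnhds).tendsto.comp hlim
  have hadj : Tendsto (fun j => ContinuousLinearMap.adjoint (hess φ (x (m j)))) atTop
      (𝓝 (ContinuousLinearMap.adjoint (hess φ xbar))) :=
    (ContinuousLinearMap.adjoint.continuous.tendsto _).comp hhess
  have hv : Tendsto (fun j => proxSubgrad φ f lam (x (m j)) (y (m j))) atTop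
      (𝓝 (-grad f xbar)) := by
    have happly : ∀ T : Rn n →L[ℝ] Rn n, Tendsto (fun p : (Rn n →L[ℝ] Rn n) × Rn n => p.1 p.2)
        (𝓝 (T, 0)) (𝓝 (T 0)) := fun T => isBoundedBilinearMap_apply.continuous.tendsto (T, 0)
    have h1 := (happly _).comp (hhess.prodMk_nhds hd)
    have h2 := (happly _).comp (hadj.prodMk_nhds hd)
    have h3 := hgrad.neg.sub ((h1.add h2).const_smul (1 / (2 * lam)))
    simpa [proxSubgrad, Function.comp_def] using h3
  exact le_of_tendsto (hgy.add (hv.inner (tendsto_const_nhds.sub hy)))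
    (.of_forall fun j => h.prob.add_inner_proxSubgrad_le h.convex (h.gen.sub_mem _)
      (h.prox_mem _) hu)

theorem isStationary (h : Run C φ f g σ lam c₁ c₂ tbar x y ξ t) {xbar : Rn n}
    (hxbar : xbar ∈ C) (hclus : MapClusterPt xbar atTop x) : IsStationary C f g xbar := by
  refine ⟨-grad f xbar, regularSubdiff_subset_subdiff _ _ ?_, add_neg_cancel _⟩
  rw [← zero_add (-grad f xbar)]
  refine add_mem_regularSubdiff (A := fun _ => 0) (B := fun z => (g z).toReal)
    (h.isOpen.mem_nhds hxbar) (fun z hz => ?_)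
    (hasGradientAt_const xbar 0) (fun z hz => h.sub_inner_grad_le hxbar hclus hz)
  rw [indicatorFun, if_pos (subset_closure hz), add_zero, zero_add,
    h.prob.g_proper.coe_toReal (h.prob.dom_g hz)]

/-- Sum rule at points of `C`: a vector satisfying the subgradient inequality of `g` on `C`, added
to `∇f`, is a limiting subgradient of the objective. -/
theorem grad_add_mem_subdiff (h : Run C φ f g σ lam c₁ c₂ tbar x y ξ t) {z v : Rn n}
    (hz : z ∈ C) (hv : ∀ u ∈ C, (g z).toReal + inner ℝ v (u - z) ≤ (g u).toReal) :
    grad f z + v ∈ subdiff (objective f g) z :=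
  regularSubdiff_subset_subdiff _ _ (add_mem_regularSubdiff (h.isOpen.mem_nhds hz)
    (fun _ hu => h.prob.objective_eq hu) (hasGradientAt_grad h.isOpen h.prob.f_C1 hz) hv)

/-! ### The Łojasiewicz inequality along the iterates -/

theorem exists_rpow_le_norm (h : Run C φ f g σ lam c₁ c₂ tbar x y ξ t) {xbar : Rn n}
    (hxbar : xbar ∈ C) (hclus : MapClusterPt xbar atTop x) {θ : ℝ} (hθ₁ : θ < 1)
    (hKL : IsKLFunctionWithExponent (objective f g) θ) :
    ∃ c : ℝ, 0 < c ∧ ∀ᶠ z in 𝓝 xbar, realObjective f g xbar < realObjective f g z →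
      ∀ w ∈ subdiff (objective f g) z,
        (realObjective f g z - realObjective f g xbar) ^ θ ≤ c * ‖w‖ := by
  obtain ⟨c, hc, v, hv, -, U, hU, hUKL⟩ := hKL xbar ⟨_, h.grad_add_mem_subdiff hxbar
    fun u hu => h.sub_inner_grad_le hxbar hclus hu⟩
  obtain ⟨ε, hε0, hεv⟩ := EReal.lt_iff_exists_real_btwn.1 hv
  have hε : 0 < ε := by exact_mod_cast hε0
  have hθ : 0 < 1 - θ := by linarith
  refine ⟨c * (1 - θ), by positivity, ?_⟩
  have hcont := h.continuousOn_realObjective.continuousAt (h.isOpen.mem_nhds hxbar)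
  filter_upwards [hU, h.isOpen.mem_nhds hxbar, hcont.tendsto.eventually_lt_const
    (by linarith : realObjective f g xbar < realObjective f g xbar + ε)] with z hzU hzC hzε hlt w hw
  have h1 := hUKL z hzU
  rw [h.prob.objective_eq hxbar, h.prob.objective_eq hzC] at h1
  have h2 := h1 (by exact_mod_cast hlt) (by
    calc (realObjective f g z : EReal) < ((realObjective f g xbar + ε : ℝ) : EReal) := by
          exact_mod_cast hzε
      _ = (realObjective f g xbar : EReal) + (ε : EReal) := EReal.coe_add _ _
      _ ≤ (realObjective f g xbar : EReal) + v := by gcongr)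
  rw [← EReal.coe_sub, EReal.toReal_coe] at h2
  set s := realObjective f g z - realObjective f g xbar with hs
  have hspos : 0 < s := sub_pos.2 hlt
  have hderiv : deriv (fun s : ℝ => c * s ^ (1 - θ)) s = c * (1 - θ) * s ^ (-θ) := by
    have := ((Real.hasDerivAt_rpow_const (p := 1 - θ) (Or.inl hspos.ne')).const_mul c).deriv
    rw [this, show 1 - θ - 1 = -θ by ring]; ring
  have h3 : Metric.infEDist 0 (subdiff (objective f g) z) ≤ ENNReal.ofReal ‖w‖ := by
    refine (Metric.infEDist_le_edist_of_mem hw).trans ?_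
    rw [edist_dist, dist_zero_left]
  have h4 : (1 : ENNReal) ≤ ENNReal.ofReal (c * (1 - θ) * s ^ (-θ) * ‖w‖) := by
    rw [ENNReal.ofReal_mul (by positivity), ← hderiv]
    exact h2.trans (by gcongr)
  rw [← ENNReal.ofReal_one, ENNReal.ofReal_le_ofReal_iff (by positivity)] at h4
  have h5 : s ^ θ * s ^ (-θ) = 1 := by rw [← Real.rpow_add hspos]; simp
  have h6 : 0 < s ^ θ := by positivity
  calc s ^ θ = s ^ θ * 1 := (mul_one _).symm
    _ ≤ s ^ θ * (c * (1 - θ) * s ^ (-θ) * ‖w‖) := by gcongr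
    _ = c * (1 - θ) * ‖w‖ * (s ^ θ * s ^ (-θ)) := by ring
    _ = c * (1 - θ) * ‖w‖ := by rw [h5, mul_one]

/-- Near an accumulation point, the objective has a subgradient at `y k` of norm at most a multiple
of `‖d k‖`. -/
theorem exists_norm_grad_add_proxSubgrad_le (h : Run C φ f g σ lam c₁ c₂ tbar x y ξ t)
    {xbar : Rn n} (hxbar : xbar ∈ C) :
    ∃ r M : ℝ, 0 < r ∧ 0 < M ∧ ∀ k, x k ∈ Metric.ball xbar r → y k ∈ Metric.ball xbar r →
      ‖grad f (y k) + proxSubgrad φ f lam (x k) (y k)‖ ≤ M * ‖y k - x k‖ := by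
  obtain ⟨r, hr, hrC⟩ := Metric.nhds_basis_closedBall.mem_iff.1 (h.isOpen.mem_nhds hxbar)
  obtain ⟨L, hL⟩ := h.lip _ (isCompact_closedBall xbar r) hrC
  obtain ⟨B, hB⟩ := (isCompact_closedBall xbar r).exists_bound_of_continuousOn
    ((continuousOn_hess h.isOpen h.prob.kernel_C2).mono hrC)
  have hlam := h.lam_pos
  have hB0 : 0 ≤ B := (norm_nonneg _).trans (hB xbar (Metric.mem_closedBall_self hr.le))
  refine ⟨r, L + 1 / lam * B + 1, hr, by positivity, fun k hx hy => ?_⟩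
  have hx' := Metric.ball_subset_closedBall hx
  have hy' := Metric.ball_subset_closedBall hy
  set d := y k - x k with hd
  have h1 : ‖hess φ (x k) d‖ ≤ B * ‖d‖ := (hess φ (x k)).le_of_opNorm_le (hB _ hx') d
  have h2 : ‖ContinuousLinearMap.adjoint (hess φ (x k)) d‖ ≤ B * ‖d‖ :=
    (ContinuousLinearMap.adjoint (hess φ (x k))).le_of_opNorm_le
      (by rw [LinearIsometryEquiv.norm_map]; exact hB _ hx') d
  have e : grad f (y k) + proxSubgrad φ f lam (x k) (y k) = (grad f (y k) - grad f (x k))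
      - (1 / (2 * lam)) • (hess φ (x k) d + ContinuousLinearMap.adjoint (hess φ (x k)) d) := by
    rw [proxSubgrad, hd]; abel
  calc ‖grad f (y k) + proxSubgrad φ f lam (x k) (y k)‖
      ≤ ‖grad f (y k) - grad f (x k)‖ + 1 / (2 * lam) * (‖hess φ (x k) d‖
        + ‖ContinuousLinearMap.adjoint (hess φ (x k)) d‖) := by
        rw [e]
        refine (norm_sub_le _ _).trans ?_
        rw [norm_smul, Real.norm_of_nonneg (by positivity)]
        gcongr
        exact norm_add_le _ _
    _ ≤ L * ‖d‖ + 1 / (2 * lam) * (B * ‖d‖ + B * ‖d‖) := by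
        gcongr
        exact hL.norm_sub_le hy' hx'
    _ = (L + 1 / lam * B) * ‖d‖ := by field_simp; ring
    _ ≤ (L + 1 / lam * B + 1) * ‖d‖ :=
        mul_le_mul_of_nonneg_right (by linarith) (norm_nonneg _)

/-- The run is a descent sequence in the abstract sense. The inequality of the objective is applied
at `y k`, where a small subgradient is known; it transfers to the gap at `x (k + 1)`, which is at
most the gap at `y k`. -/
theorem exists_lojasiewiczDescent (h : Run C φ f g σ lam c₁ c₂ tbar x y ξ t) {xbar : Rn n}
    (hxbar : xbar ∈ C) (hclus : MapClusterPt xbar atTop x) {θ : ℝ} (hθ₀ : 0 ≤ θ) (hθ₁ : θ < 1)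
    (hKL : IsKLFunctionWithExponent (objective f g) θ) :
    ∃ (ρ a c : ℝ) (K : ℕ), LojasiewiczDescent x (fun k => ‖y k - x k‖)
      (fun k => realObjective f g (x k) - realObjective f g xbar) xbar ρ a (max 1 tbar) c θ K := by
  obtain ⟨r₁, a, hr₁, ha, K₁, hdec⟩ := h.exists_quadratic_decrease hxbar hclus
  obtain ⟨r₂, M, hr₂, hM, hsub⟩ := h.exists_norm_grad_add_proxSubgrad_le hxbar
  obtain ⟨c, hc, hloj⟩ := h.exists_rpow_le_norm hxbar hclus hθ₁ hKL
  obtain ⟨r₃, hr₃, hloj⟩ := Metric.eventually_nhds_iff_ball.1 hloj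
  have hψ := h.tendsto_realObjective hxbar hclus
  have hanti := h.antitone_realObjective
  have hgap : Tendsto (fun k => realObjective f g (x k) - realObjective f g xbar) atTop (𝓝 0) := by
    simpa using hψ.sub_const (realObjective f g xbar)
  have hgap0 : ∀ k, 0 ≤ realObjective f g (x k) - realObjective f g xbar := fun k =>
    sub_nonneg.2 (hanti.le_of_tendsto hψ k)
  set R := min r₂ r₃ with hR
  have hRpos : 0 < R := lt_min hr₂ hr₃
  have hsq : Tendsto (fun k => √((realObjective f g (x k) - realObjective f g xbar) / a)) atTop
      (𝓝 0) := by
    simpa using (hgap.div_const a).sqrt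
  obtain ⟨K₂, hK₂⟩ := eventually_atTop.1 (hsq.eventually_lt_const (half_pos hRpos))
  have hdec' : ∀ k ≥ max K₁ K₂, x k ∈ Metric.ball xbar (min r₁ (R / 2)) →
      a * ‖y k - x k‖ ^ 2 ≤ realObjective f g (x k) - realObjective f g (x (k + 1)) :=
    fun k hk hx => hdec k ((le_max_left _ _).trans hk)
      (Metric.ball_subset_ball (min_le_left _ _) hx)
  refine ⟨min r₁ (R / 2), a, c * M, max K₁ K₂, lt_min hr₁ (half_pos hRpos), ha,
    lt_of_lt_of_le one_pos (le_max_left _ _), by positivity, hθ₀, hθ₁, fun k => norm_nonneg _,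
    hgap0, fun i j hij => sub_le_sub_right (hanti hij) _, hgap, hclus, h.norm_step_le,
    fun k hk hx => ?_, fun k hk hx hpos => ?_⟩
  · linarith [hdec' k hk hx]
  have hd : ‖y k - x k‖ < R / 2 := by
    refine lt_of_le_of_lt ?_ (hK₂ k ((le_max_right _ _).trans hk))
    apply Real.le_sqrt_of_sq_le
    rw [le_div_iff₀ ha]
    linarith [hdec' k hk hx, hgap0 (k + 1)]
  have hxR : x k ∈ Metric.ball xbar (R / 2) := Metric.ball_subset_ball (min_le_right _ _) hx
  have hyR : y k ∈ Metric.ball xbar R := by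
    rw [Metric.mem_ball, dist_eq_norm] at hxR ⊢
    have : ‖y k - xbar‖ ≤ ‖y k - x k‖ + ‖x k - xbar‖ := norm_sub_le_norm_sub_add_norm_sub _ _ _
    linarith
  have hle : realObjective f g (x (k + 1)) ≤ realObjective f g (y k) := by
    have h1 := (h.objective_succ_le k).1
    rw [h.prob.objective_eq (h.gen.mem (k + 1)), h.prob.objective_eq (h.prox_mem k)] at h1
    exact_mod_cast h1
  have h1 := hloj (y k) (Metric.ball_subset_ball (min_le_right _ _) hyR) (by linarith) _
    (h.grad_add_mem_subdiff (h.prox_mem k) fun u hu =>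
      h.prob.add_inner_proxSubgrad_le h.convex (h.gen.sub_mem k) (h.prox_mem k) hu)
  have h2 := hsub k (Metric.ball_subset_ball (by linarith [min_le_left r₂ r₃]) hxR)
    (Metric.ball_subset_ball (min_le_left _ _) hyR)
  calc (realObjective f g (x (k + 1)) - realObjective f g xbar) ^ θ
      ≤ (realObjective f g (y k) - realObjective f g xbar) ^ θ :=
        Real.rpow_le_rpow hpos.le (by linarith) hθ₀
    _ ≤ c * ‖grad f (y k) + proxSubgrad φ f lam (x k) (y k)‖ := h1
    _ ≤ c * (M * ‖y k - x k‖) := by gcongr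
    _ = c * M * ‖y k - x k‖ := by ring

theorem exists_mapClusterPt (h : Run C φ f g σ lam c₁ c₂ tbar x y ξ t)
    (hlevel : LevelBounded (objective f g)) : ∃ z ∈ closure C, MapClusterPt z atTop x := by
  have hmem : ∀ k, x k ∈ closure {z | objective f g z ≤ (realObjective f g (x 0) : EReal)} :=
    fun k => subset_closure (by
      change objective f g (x k) ≤ _
      rw [h.prob.objective_eq (h.gen.mem k)]
      exact_mod_cast h.antitone_realObjective (Nat.zero_le k))
  obtain ⟨z, -, hz⟩ := (hlevel _).isCompact_closure.exists_mapClusterPt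
    (f := atTop) (u := x) (tendsto_principal.2 (.of_forall hmem))
  exact ⟨z, mem_closure_iff_clusterPt.2 (hz.clusterPt.mono (le_principal_iff.2
    (mem_map.2 (univ_mem' h.gen.mem)))), hz⟩

end Run

end ABPG

theorem mainTheorem3 {n : ℕ} (C : Set (ABPG.Rn n))
    (hC_open : IsOpen C) (hC_convex : Convex ℝ C) (hC_nonempty : C.Nonempty)
    (φ f g : ABPG.Rn n → EReal)
    (hprob : ABPG.ProblemAssumptions C φ f g)
    (hfeas : ABPG.Feasibility C φ f g)
    (σ : ℝ) (hσ : 0 < σ) (hstrong : StrongConvexOn C σ (fun x => (φ x).toReal))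
    (hlevel : ABPG.LevelBounded (ABPG.objective f g))
    (hlip : ABPG.LocallyLipschitzGrad C f)
    (lam c₁ c₂ : ℝ) (hlam : 0 < lam) (hc₁ : 0 < c₁) (hc₁₂ : c₁ < c₂) (hc₂ : c₂ < 1)
    (x y ξ : ℕ → ABPG.Rn n) (t : ℕ → ℝ)
    (hgen : ABPG.GeneratedByABPG C φ f g lam c₁ c₂ x y ξ t)
    (ht : ∃ tbar : ℝ, ∀ k, t k < tbar)
    (θ : ℝ) (hθ₀ : 0 ≤ θ) (hθ₁ : θ < 1)
    (hKL : ABPG.IsKLFunctionWithExponent (ABPG.objective f g) θ) :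
    (∃ z ∈ closure C, MapClusterPt z Filter.atTop x) ∧
    ∀ xbar ∈ C, MapClusterPt xbar Filter.atTop x →
      ABPG.IsStationary C f g xbar ∧
      Filter.Tendsto x Filter.atTop (nhds xbar) ∧
      (θ = 0 → ∃ N : ℕ, ∀ k ≥ N, x k = xbar) ∧
      (0 < θ → θ ≤ 1 / 2 →
        ∃ a η : ℝ, 0 < a ∧ 0 ≤ η ∧ η < 1 ∧ ∀ k : ℕ, ‖x k - xbar‖ < a * η ^ k) ∧
      (1 / 2 < θ →
        ∃ b : ℝ, 0 < b ∧ ∀ k : ℕ, 1 ≤ k →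
          ‖x k - xbar‖ < b * (k : ℝ) ^ (-((1 - θ) / (2 * θ - 1)))) := by
  obtain ⟨tbar, htbar⟩ := ht
  have h : ABPG.Run C φ f g σ lam c₁ c₂ tbar x y ξ t :=
    ⟨hC_open, hC_convex, hprob, hfeas, hσ, hstrong, hlip, hlam, hc₁, hc₂, hgen, htbar⟩
  refine ⟨h.exists_mapClusterPt hlevel, fun xbar hxbar hclus => ?_⟩
  obtain ⟨ρ, a, c, K, hdesc⟩ := h.exists_lojasiewiczDescent hxbar hclus hθ₀ hθ₁ hKL
  exact ⟨h.isStationary hxbar hclus, hdesc.exists_norm_sub_le.1, hdesc.eventually_eq,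
    fun _ => hdesc.exists_norm_sub_lt_geometric, hdesc.exists_norm_sub_lt_rpow⟩
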